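/- Let $L>0$, $0<v<1$, $T>0$, and put $\mathbf I_t=(vt,L+vt)$, $\gamma_v=\frac{1+v}{1-v}$, $L_1=\frac{1-v}{1+v}L$, $L_2=\frac{2L}{1-v}$. Let $\phi^0\in H^1_0(\mathbf I_0)$ and $\phi^1\in L^2(\mathbf I_0)$ be real-valued, and let $\phi$ be a solution of $$\phi_{tt}=\phi_{xx}\ \ (x\in\mathbf I_t,\ 0<t<T),\qquad \phi(vt,t)=\phi(L+vt,t)=0,\qquad \phi(\cdot,0)=\phi^0,\quad \phi_t(\cdot,0)=\phi^1,$$ with $\phi\in C([0,T];H^1_0(\mathbf I_t))$ and $\phi_t\in C([0,T];L^2(\mathbf I_t))$, the wave equation being understood in the sense of distributions. For $t\in[0,T]$ let $\tilde\phi_x(\cdot,t)$ and $\tilde\phi_t(\cdot,t)$ be the extensions of $\phi_x(\cdot,t)$ and $\phi_t(\cdot,t)$ from $\mathbf I_t$ to $(-L_1+vt,L_2+vt)$ given by $$\tilde\phi_x(x,t)=\gamma_v\,\phi_x(y,t),\quad \tilde\phi_t(x,t)=-\gamma_v\,\phi_t(y,t),\qquad y=\gamma_v(vt-x)+vt,\qquad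 x\in(-L_1+vt,vt),$$ $$\tilde\phi_x(x,t)=\tfrac1{\gamma_v}\phi_x(y,t),\quad \tilde\phi_t(x,t)=-\tfrac1{\gamma_v}\phi_t(y,t),\qquad y=\tfrac1{\gamma_v}(vt-x)+\tfrac{2L}{1+v}+vt,\qquad x\in(L+vt,L_2+vt),$$ and write $\tilde\phi^0_x$, $\tilde\phi^1$ for the extensions of $\phi^0_x$, $\phi^1$ by the same formulas at $t=0$. For $n\in\mathbb Z\setminus\{0\}$ let $$c_n=\frac1{4n\pi i}\int_0^{L_2}(\tilde\phi^0_x+\tilde\phi^1)\,e^{-n\pi i(1-v)x/L}\,dx .$$ Then these numbers also satisfy $c_n=\frac1{4n\pi i}\int_{-L_1}^{L}(\tilde\phi^0_x-\tilde\phi^1)\,e^{n\pi i(1+v)x/L}\,dx$, and they are the coefficients of the expansion $$\phi(x,t)=\sum_{n\ne0}c_n\left(e^{n\pi i(1-v)(t+x)/L}-e^{n\pi i(1+v)(t-x)/L}\right),\qquad t\in[0,T],\ x\in\mathbf I_t.$$ Moreover, the sum $\sum_{n\neq0}|nc_n|^2$ is finite and, for every $t\in[0,T]$ (hence for every $t\ge0$,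 since $T$ is arbitrary and the $c_n$ depend only on the initial data), $$\sum_{n\ne0}|nc_n|^2=\frac{L}{8\pi^2(1-v)}\int_{vt}^{L_2+vt}(\tilde\phi_x+\tilde\phi_t)^2\,dx=\frac{L}{8\pi^2(1+v)}\int_{-L_1+vt}^{L+vt}(\tilde\phi_x-\tilde\phi_t)^2\,dx .$$ -/

import Mathlib

open MeasureTheory Filter Topology Set
open scoped ContDiff

noncomputable section

namespace MovingString

/-- `f ∈ H₀¹(a, b)` with weak derivative `f'`: in one space dimension, this means that the continuous
representative `f` vanishes at both endpoints and that its distributional derivative `f'` on `(a, b)`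
is square integrable (`f` itself is then square integrable, being continuous on `[a, b]`). -/
structure IsH10 (a b : ℝ) (f f' : ℝ → ℝ) : Prop where
  continuousOn : ContinuousOn f (Icc a b)
  left_eq_zero : f a = 0
  right_eq_zero : f b = 0
  memLp_deriv : MemLp f' 2 (volume.restrict (Ioo a b))
  weak_deriv : ∀ ψ : ℝ → ℝ, ContDiff ℝ ∞ ψ → HasCompactSupport ψ → tsupport ψ ⊆ Ioo a b →
    ∫ x in a..b, f x * deriv ψ x = -∫ x in a..b, f' x * ψ x

/-- The open space-time domain `{(x, t) : 0 < t < T, vt < x < L + vt}`. -/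
def domain (v L T : ℝ) : Set (ℝ × ℝ) :=
  {p | 0 < p.2 ∧ p.2 < T ∧ v * p.2 < p.1 ∧ p.1 < L + v * p.2}

/-- Smooth functions of `(x, t)` with compact support in the open space-time domain. -/
structure IsTest (v L T : ℝ) (ψ : ℝ × ℝ → ℝ) : Prop where
  contDiff : ContDiff ℝ ∞ ψ
  hasCompactSupport : HasCompactSupport ψ
  tsupport_subset : tsupport ψ ⊆ domain v L T

/-- The partial derivative in the space variable. -/
def partialX (ψ : ℝ × ℝ → ℝ) (x t : ℝ) : ℝ := deriv (fun y => ψ (y, t)) x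

/-- The partial derivative in the time variable. -/
def partialT (ψ : ℝ × ℝ → ℝ) (x t : ℝ) : ℝ := deriv (fun s => ψ (x, s)) t

/-- Continuity of `t ↦ u(·, t) ∈ L²(vt, L + vt)` on `[0, T]`, where the moving interval is
identified with `(0, L)` by the translation `x ↦ x + vt`. -/
def IsContinuousL2 (v L T : ℝ) (u : ℝ → ℝ → ℝ) : Prop :=
  ∀ t ∈ Icc 0 T, Tendsto (fun s => ∫ x in (0 : ℝ)..L, (u (x + v * s) s - u (x + v * t) t) ^ 2)
    (𝓝[Icc 0 T] t) (𝓝 0)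

/-- `φ`, a function of `(x, t)`, is the finite-energy solution on `[0, T]` of
`φ_tt = φ_xx` for `vt < x < L + vt`, `φ(vt, t) = φ(L + vt, t) = 0`, `φ(x, 0) = φ0(x)`,
`φ_t(x, 0) = φ1(x)`, and `φx`, `φt` are its weak derivatives. Thus
`φ ∈ C([0, T]; H₀¹(vt, L + vt))`, `φ_t ∈ C([0, T]; L²(vt, L + vt))` and the wave equation holds in
the sense of distributions. Space-time integrals are written as iterated integrals; in each of them
the inner integral is a continuous function of `t`. -/
structure IsSolution (v L T : ℝ) (φ0 φ1 : ℝ → ℝ) (φ φx φt : ℝ → ℝ → ℝ) : Prop where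
  isH10 : ∀ t ∈ Icc 0 T, IsH10 (v * t) (L + v * t) (fun x => φ x t) (fun x => φx x t)
  memLp_t : ∀ t ∈ Icc 0 T, MemLp (fun x => φt x t) 2 (volume.restrict (Ioo (v * t) (L + v * t)))
  continuous : IsContinuousL2 v L T φ
  continuous_x : IsContinuousL2 v L T φx
  continuous_t : IsContinuousL2 v L T φt
  weak_deriv_t : ∀ ψ, IsTest v L T ψ →
    ∫ t in (0 : ℝ)..T, ∫ x in (v * t)..(L + v * t), φ x t * partialT ψ x t
      = -∫ t in (0 : ℝ)..T, ∫ x in (v * t)..(L + v * t), φt x t * ψ (x, t)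
  wave : ∀ ψ, IsTest v L T ψ →
    ∫ t in (0 : ℝ)..T, ∫ x in (v * t)..(L + v * t),
      (φt x t * partialT ψ x t - φx x t * partialX ψ x t) = 0
  initial : ∀ x ∈ Ioo 0 L, φ x 0 = φ0 x
  initial_t : ∀ᵐ x ∂(volume.restrict (Ioo 0 L)), φt x 0 = φ1 x

/-- `γ_v = (1 + v) / (1 - v)`. -/
def gam (v : ℝ) : ℝ := (1 + v) / (1 - v)

/-- `L₁ = (1 - v) L / (1 + v)`. -/
def L1 (v L : ℝ) : ℝ := (1 - v) / (1 + v) * L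

/-- `L₂ = 2 L / (1 - v)`. -/
def L2 (v L : ℝ) : ℝ := 2 / (1 - v) * L

/-- The extension of `φ_x(·, t)` from `(vt, L + vt)` to `(-L₁ + vt, L₂ + vt)`; here
`g = φ_x(·, t)`. -/
def extX (v L t : ℝ) (g : ℝ → ℝ) (x : ℝ) : ℝ :=
  if x < v * t then gam v * g (gam v * (v * t - x) + v * t)
  else if x < L + v * t then g x
  else 1 / gam v * g (1 / gam v * (v * t - x) + 2 * L / (1 + v) + v * t)

/-- The extension of `φ_t(·, t)` from `(vt, L + vt)` to `(-L₁ + vt, L₂ + vt)`; here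
`g = φ_t(·, t)`. -/
def extT (v L t : ℝ) (g : ℝ → ℝ) (x : ℝ) : ℝ :=
  if x < v * t then -gam v * g (gam v * (v * t - x) + v * t)
  else if x < L + v * t then g x
  else -1 / gam v * g (1 / gam v * (v * t - x) + 2 * L / (1 + v) + v * t)

/-- The coefficient `c_n` (`n ≠ 0`), computed from the initial data on `(0, L₂)`; `φ0x` is the
derivative of the initial shape and `φ1` is the initial velocity. -/
def coeff (v L : ℝ) (φ0x φ1 : ℝ → ℝ) (n : ℤ) : ℂ :=
  1 / (4 * n * Real.pi * Complex.I) *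
    ∫ x in (0 : ℝ)..(L2 v L), ((extX v L 0 φ0x x + extT v L 0 φ1 x : ℝ) : ℂ) *
      Complex.exp (-(n * Real.pi * Complex.I * (1 - v) * x / L))

/-- The coefficient `c_n` (`n ≠ 0`), computed from the initial data on `(-L₁, L)`. -/
def coeff' (v L : ℝ) (φ0x φ1 : ℝ → ℝ) (n : ℤ) : ℂ :=
  1 / (4 * n * Real.pi * Complex.I) *
    ∫ x in (-L1 v L)..L, ((extX v L 0 φ0x x - extT v L 0 φ1 x : ℝ) : ℂ) *
      Complex.exp (n * Real.pi * Complex.I * (1 + v) * x / L)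

end MovingString

end

/-! ### Distributions on an interval and functions of class H₀¹ -/

namespace MovingString

/-! For a smooth profile `e`, the function `e (t + x) - e (γ (t - x))` with `γ = (1 + v) / (1 - v)`
solves the wave equation. It vanishes on `x = v t`, where both phases agree, and also on `x = L + v
t` if `e` has period `L₂ = (1 + γ) L`, where the phases differ by one period. Green's identity on
the moving interval therefore gives a conserved quantity: the Wronskian of `φ` with each such wave
(`IsSolution.wronskian_eq`). Taking cosine and sine profiles, one finds that every mode amplitude
`modeIntegral` is constant in time (`IsSolution.modeIntegral_eq`).

Since `φ` is only a weak solution, Green's identity is obtained by testing with the wave times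
cutoffs in time and space (`integral_cutoff_eq_zero`). The derivative of the space cutoff is of size
`1 / ε` on a strip of width of order `ε`. Both the wave and `φ` are small there because they vanish
on the boundary, so the error is `O(√ε)` (`exists_cutoff_error_le`).

The extensions are chosen so that reflecting the added piece back into the string turns the sum `φ_x
+ φ_t` into the difference `φ_x - φ_t`, and conversely. Hence the Fourier coefficients of the
extended sum on an interval of length `L₂` are, up to a phase, the conserved amplitudes
(`integral_ext_add_mul_mode`), and the coefficient of index zero vanishes by the boundary
conditions. Parseval's identity at time `t` is then the energy identity (`hasSum_norm_sq`).
Parseval's identity against the indicator of the interval from `x` to its reflected point gives the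
expansion of `φ (x, t)` (`hasSum_expansion`), because the extended sum has integral `-2 φ (x, t)`
over that interval. -/

/-- A smooth function supported in `(a, b)` with vanishing integral is the derivative of such a
function. -/
lemma exists_test_deriv_eq {a b : ℝ} (hab : a < b) {h : ℝ → ℝ} (hs : ContDiff ℝ ∞ h)
    (hc : HasCompactSupport h) (hsub : tsupport h ⊆ Ioo a b) (hint : ∫ x in a..b, h x = 0) :
    ∃ ψ : ℝ → ℝ, ContDiff ℝ ∞ ψ ∧ HasCompactSupport ψ ∧ tsupport ψ ⊆ Ioo a b ∧ deriv ψ = h := by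
  obtain ⟨a', b', ha', hb', hab', hK⟩ : ∃ a' b', a < a' ∧ b' < b ∧ a' ≤ b' ∧
      tsupport h ⊆ Icc a' b' := by
    rcases (tsupport h).eq_empty_or_nonempty with he | hne
    · exact ⟨(a + b) / 2, (a + b) / 2, by linarith, by linarith, le_rfl, by simp [he]⟩
    · have hcomp : IsCompact (tsupport h) := hc
      obtain ⟨m, hm⟩ := hcomp.exists_isLeast hne
      obtain ⟨M, hM⟩ := hcomp.exists_isGreatest hne
      exact ⟨m, M, (hsub hm.1).1, (hsub hM.1).2, hm.2 hM.1, fun x hx => ⟨hm.2 hx, hM.2 hx⟩⟩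
  have hz : ∀ x, x ∉ Icc a' b' → h x = 0 := fun x hx =>
    image_eq_zero_of_notMem_tsupport (fun hx' => hx (hK hx'))
  have hcont : Continuous h := hs.continuous
  have hderiv : ∀ x, HasDerivAt (fun x => ∫ t in a..x, h t) (h x) x := fun x =>
    intervalIntegral.integral_hasDerivAt_right (hcont.intervalIntegrable _ _)
      hcont.stronglyMeasurable.stronglyMeasurableAtFilter hcont.continuousAt
  have hd : deriv (fun x => ∫ t in a..x, h t) = h := funext fun x => (hderiv x).deriv
  have hsupp : ∀ x, x ∉ Icc a' b' → ∫ t in a..x, h t = 0 := by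
    intro x hx
    rcases lt_or_ge x a' with hxa | hxa
    · refine intervalIntegral.integral_zero_ae (ae_of_all _ fun t ht => hz t fun ht' => ?_)
      have := ht.2
      rcases le_max_iff.1 this with h1 | h1 <;> linarith [ht'.1]
    -- To the right of the support the primitive equals the full integral, so the vanishing mean is
    -- needed here.
    · have hxb : b' < x := by
        by_contra! hh
        exact hx ⟨hxa, hh⟩
      have h1 : ∫ t in x..b, h t = 0 := by
        refine intervalIntegral.integral_zero_ae (ae_of_all _ fun t ht => hz t fun ht' => ?_)
        have := ht.1
        rcases min_lt_iff.1 this with h1 | h1 <;> linarith [ht'.2]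
      have h2 := intervalIntegral.integral_add_adjacent_intervals
        (hcont.intervalIntegrable a x (μ := volume)) (hcont.intervalIntegrable x b)
      rw [h1, hint] at h2
      linarith
  have hts : tsupport (fun x => ∫ t in a..x, h t) ⊆ Icc a' b' :=
    closure_minimal (fun x hx => by_contra fun hx' => hx (hsupp x hx')) isClosed_Icc
  refine ⟨fun x => ∫ t in a..x, h t, ?_, ?_, ?_, hd⟩
  · rw [contDiff_infty_iff_deriv]
    exact ⟨fun x => (hderiv x).differentiableAt, by rw [hd]; exact hs⟩
  · exact HasCompactSupport.of_support_subset_isCompact isCompact_Icc (subset_closure.trans hts)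
  · exact hts.trans (Icc_subset_Ioo ha' hb')

/-- The lemma of du Bois-Reymond: a function on an interval whose distributional derivative
vanishes is constant. -/
lemma exists_ae_eq_const_of_integral_mul_deriv_eq_zero {a b : ℝ} (hab : a < b) {f : ℝ → ℝ}
    (hf : IntegrableOn f (Ioo a b))
    (h : ∀ ψ : ℝ → ℝ, ContDiff ℝ ∞ ψ → HasCompactSupport ψ → tsupport ψ ⊆ Ioo a b →
      ∫ x in a..b, f x * deriv ψ x = 0) :
    ∃ c, ∀ᵐ x, x ∈ Ioo a b → f x = c := by
  let B : ContDiffBump ((a + b) / 2 : ℝ) := ⟨(b - a) / 8, (b - a) / 4, by linarith, by linarith⟩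
  set ρ : ℝ → ℝ := B.normed volume with hρ
  have hρs : ContDiff ℝ ∞ ρ := B.contDiff_normed
  have hρc : HasCompactSupport ρ := B.hasCompactSupport_normed
  have hρt : tsupport ρ ⊆ Ioo a b := by
    rw [hρ, B.tsupport_normed_eq, Real.closedBall_eq_Icc]
    apply Icc_subset_Ioo <;> simp only [B] <;> linarith
  have hwhole : ∀ {u : ℝ → ℝ}, tsupport u ⊆ Ioo a b → ∫ x in a..b, u x = ∫ x, u x := by
    intro u hu
    rw [intervalIntegral.integral_of_le hab.le]
    exact setIntegral_eq_integral_of_forall_compl_eq_zero fun x hx =>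
      image_eq_zero_of_notMem_tsupport fun hx' => hx (Ioo_subset_Ioc_self (hu hx'))
  have hρ1 : ∫ x in a..b, ρ x = 1 := by rw [hwhole hρt]; exact B.integral_normed
  have hfi : IntervalIntegrable f volume a b := by
    rwa [intervalIntegrable_iff_integrableOn_Ioo_of_le hab.le]
  refine ⟨∫ x in a..b, f x * ρ x, ?_⟩
  have key := isOpen_Ioo.ae_eq_zero_of_integral_contDiff_smul_eq_zero (μ := volume)
    (U := Ioo a b) (f := fun x => f x - ∫ x in a..b, f x * ρ x)
    ((hf.sub (integrableOn_const (by simp))).locallyIntegrableOn) ?_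
  · filter_upwards [key] with x hx hx'
    linarith [hx hx']
  intro g hg hgc hgt
  set I := ∫ x in a..b, g x with hI
  have hgi : IntervalIntegrable g volume a b := hg.continuous.intervalIntegrable _ _
  have hρi : IntervalIntegrable ρ volume a b := hρs.continuous.intervalIntegrable _ _
  -- Subtracting the multiple of `ρ` with the same integral makes any test function a derivative of
  -- a test function.
  obtain ⟨ψ, hψ, hψc, hψt, hψd⟩ := exists_test_deriv_eq hab (h := fun x => g x - I * ρ x)
    (hg.sub (contDiff_const.mul hρs)) (hgc.sub (hρc.mul_left))
    (by
      refine (tsupport_sub _ _).trans (union_subset hgt ?_)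
      exact (closure_mono (Function.support_mul_subset_right _ _)).trans hρt)
    (by
      rw [intervalIntegral.integral_sub hgi (hρi.const_mul _),
        intervalIntegral.integral_const_mul, hρ1, mul_one, sub_self])
  have h1 := h ψ hψ hψc hψt
  have hfg : IntervalIntegrable (fun x => f x * g x) volume a b :=
    hfi.mul_continuousOn hg.continuous.continuousOn
  have hfρ : IntervalIntegrable (fun x => f x * ρ x) volume a b :=
    hfi.mul_continuousOn hρs.continuous.continuousOn
  have h2 : ∫ x in a..b, f x * deriv ψ x
      = (∫ x in a..b, f x * g x) - I * ∫ x in a..b, f x * ρ x := by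
    rw [hψd, ← intervalIntegral.integral_const_mul,
      ← intervalIntegral.integral_sub hfg (hfρ.const_mul _)]
    congr 1; ext x; ring
  rw [← hwhole]
  · have : ∀ x, g x • (f x - ∫ x in a..b, f x * ρ x)
        = f x * g x - (∫ x in a..b, f x * ρ x) * g x := fun x => by simp only [smul_eq_mul]; ring
    simp_rw [this]
    rw [intervalIntegral.integral_sub hfg (hgi.const_mul _), intervalIntegral.integral_const_mul,
      ← hI]
    linarith
  · exact (closure_mono (Function.support_smul_subset_left _ _)).trans hgt

/-- Integration by parts for the primitive of an integrable function. -/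
lemma integral_primitive_mul_deriv {a b : ℝ} {f w w' : ℝ → ℝ}
    (hf : IntervalIntegrable f volume a b) (hw : ∀ x, HasDerivAt w (w' x) x) (hw' : Continuous w') :
    ∫ x in a..b, (∫ y in a..x, f y) * w' x
      = (∫ y in a..b, f y) * w b - ∫ x in a..b, f x * w x := by
  have hac := hf.absolutelyContinuousOnInterval_intervalIntegral (c := a) (by simp)
  have hwd : deriv w = w' := funext fun x => (hw x).deriv
  have hwac : AbsolutelyContinuousOnInterval w a b := by
    refine ContDiffOn.absolutelyContinuousOnInterval (ContDiff.contDiffOn ?_)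
    rw [contDiff_one_iff_deriv, hwd]
    exact ⟨fun x => (hw x).differentiableAt, hw'⟩
  have h := hac.integral_mul_deriv_eq_deriv_mul hwac
  rw [hwd] at h
  rw [h, intervalIntegral.integral_same, zero_mul, sub_zero]
  congr 1
  apply intervalIntegral.integral_congr_ae
  filter_upwards [hf.ae_hasDerivAt_integral] with x hx hx'
  rw [(hx (uIoc_subset_uIcc hx') a (by simp)).deriv]

namespace IsH10

variable {a b : ℝ} {f f' : ℝ → ℝ}

lemma intervalIntegrable_deriv (hf : IsH10 a b f f') (hab : a < b) :
    IntervalIntegrable f' volume a b := by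
  rw [intervalIntegrable_iff_integrableOn_Ioo_of_le hab.le]
  exact hf.memLp_deriv.integrable (by norm_num)

/-- The difference of `f` and this primitive is continuous with vanishing distributional derivative,
hence constant; the constant is zero because both vanish at `a`. -/
lemma eq_integral (hf : IsH10 a b f f') (hab : a < b) {x : ℝ} (hx : x ∈ Icc a b) :
    f x = ∫ y in a..x, f' y := by
  have hi := hf.intervalIntegrable_deriv hab
  have hcont : ContinuousOn (fun x => ∫ y in a..x, f' y) (Icc a b) := by
    have := hi.absolutelyContinuousOnInterval_intervalIntegral (c := a) (by simp)
    simpa [uIcc_of_le hab.le] using this.continuousOn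
  have hdiff : ContinuousOn (fun x => f x - ∫ y in a..x, f' y) (Icc a b) :=
    hf.continuousOn.sub hcont
  obtain ⟨c, hc⟩ := exists_ae_eq_const_of_integral_mul_deriv_eq_zero hab
    (f := fun x => f x - ∫ y in a..x, f' y)
    ((hdiff.integrableOn_Icc).mono_set Ioo_subset_Icc_self) (by
      intro ψ hψ hψc hψt
      have hψ' : Continuous (deriv ψ) := hψ.continuous_deriv (by simp)
      have h1 := hf.weak_deriv ψ hψ hψc hψt
      have h2 := integral_primitive_mul_deriv hi
        (fun x => (hψ.differentiable (by simp) x).hasDerivAt) hψ'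
      have hb : ψ b = 0 := image_eq_zero_of_notMem_tsupport fun h => lt_irrefl _ (hψt h).2
      simp_rw [sub_mul]
      rw [intervalIntegral.integral_sub, h1, h2, hb]
      · ring
      · exact (hf.continuousOn.mul hψ'.continuousOn).intervalIntegrable_of_Icc hab.le
      · exact (hcont.mul hψ'.continuousOn).intervalIntegrable_of_Icc hab.le)
  have heq : EqOn (fun x => f x - ∫ y in a..x, f' y) (fun _ => c) (Icc a b) := by
    refine Measure.eqOn_Icc_of_ae_eq (μ := volume) hab.ne ?_ hdiff continuousOn_const
    rw [← restrict_Ioo_eq_restrict_Icc]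
    exact (ae_restrict_iff' measurableSet_Ioo).2 hc
  have h0 := heq (left_mem_Icc.2 hab.le)
  have h1 := heq hx
  simp only [intervalIntegral.integral_same, hf.left_eq_zero] at h0 h1
  linarith

lemma integral_deriv_eq_zero (hf : IsH10 a b f f') (hab : a < b) : ∫ y in a..b, f' y = 0 := by
  rw [← hf.eq_integral hab (right_mem_Icc.2 hab.le), hf.right_eq_zero]

/-- The weight need not vanish at the endpoints: the boundary term carries the factor `∫ f' = f b =
0`. -/
lemma integral_deriv_mul (hf : IsH10 a b f f') (hab : a < b) {w w' : ℝ → ℝ}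
    (hw : ∀ x, HasDerivAt w (w' x) x) (hw' : Continuous w') :
    ∫ x in a..b, f' x * w x = -∫ x in a..b, f x * w' x := by
  have h := integral_primitive_mul_deriv (hf.intervalIntegrable_deriv hab) hw hw'
  rw [hf.integral_deriv_eq_zero hab, zero_mul, zero_sub] at h
  rw [eq_neg_iff_add_eq_zero, add_comm, ← eq_neg_iff_add_eq_zero, ← h]
  refine intervalIntegral.integral_congr fun x hx => ?_
  rw [uIcc_of_le hab.le] at hx
  simp only [hf.eq_integral hab hx]

end IsH10

/-! ### Parseval's identity and the Cauchy-Schwarz inequality -/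

open AddCircle ComplexConjugate in
/-- Parseval's identity for the inner product of two functions which are square integrable on an
interval. -/
lemma hasSum_conj_fourierCoeffOn_mul {a b : ℝ} {f g : ℝ → ℂ} (hab : a < b)
    (hf : MemLp f 2 (volume.restrict (Ioc a b))) (hg : MemLp g 2 (volume.restrict (Ioc a b))) :
    HasSum (fun i => conj (fourierCoeffOn hab f i) * fourierCoeffOn hab g i)
      (((b - a)⁻¹ : ℝ) • ∫ x in a..b, conj (f x) * g x) := by
  have := Fact.mk (by linarith : 0 < b - a)
  rw [← add_sub_cancel a b] at hf hg
  have hF := hf.memLp_liftIoc.haarAddCircle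
  have hG := hg.memLp_liftIoc.haarAddCircle
  have h := fourierBasis.hasSum_inner_mul_inner hF.toLp hG.toLp
  have h1 : ∀ i, conj (fourierCoeffOn hab f i) * fourierCoeffOn hab g i
      = inner ℂ hF.toLp (fourierBasis i) * inner ℂ (fourierBasis i) hG.toLp := by
    intro i
    rw [← inner_conj_symm, ← HilbertBasis.repr_apply_apply, ← HilbertBasis.repr_apply_apply,
      fourierBasis_repr, fourierBasis_repr, fourierCoeff_congr_ae hF.coeFn_toLp,
      fourierCoeff_congr_ae hG.coeFn_toLp]
    simp [fourierCoeff_liftIoc_eq]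
  have h2 : ((b - a)⁻¹ : ℝ) • ∫ x in a..b, conj (f x) * g x = inner ℂ hF.toLp hG.toLp := by
    rw [L2.inner_def]
    nth_rw 2 [← add_sub_cancel a b]
    rw [← AddCircle.integral_liftIoc_eq_intervalIntegral, ← AddCircle.integral_haarAddCircle]
    apply integral_congr_ae
    filter_upwards [hF.coeFn_toLp, hG.coeFn_toLp] with x hx hy
    rw [hx, hy, RCLike.inner_apply']
    rfl
  simp_rw [h1, h2]
  exact h

/-- The Cauchy-Schwarz inequality against the constant function `1`. -/
lemma sq_integral_abs_le {α : Type*} [MeasurableSpace α] {μ : Measure α} [IsFiniteMeasure μ]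
    {u : α → ℝ} (hu : MemLp u 2 μ) : (∫ x, |u x| ∂μ) ^ 2 ≤ μ.real univ * ∫ x, u x ^ 2 ∂μ := by
  set I := ∫ x, |u x| ∂μ with hI
  set s := μ.real univ with hs
  have hs0 : 0 ≤ s := measureReal_nonneg
  have h1 : Integrable (fun x => |u x|) μ := (hu.integrable (by norm_num)).abs
  have h2 : Integrable (fun x => u x ^ 2) μ := hu.integrable_sq
  -- The variance argument: the nonnegative integral of this square is `s` times the defect in the
  -- inequality.
  have h3 : ∫ x, (s * |u x| - I) ^ 2 ∂μ = s * (s * (∫ x, u x ^ 2 ∂μ) - I ^ 2) := by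
    have : ∀ x, (s * |u x| - I) ^ 2 = s ^ 2 * u x ^ 2 - (2 * s * I) * |u x| + I ^ 2 := by
      intro x
      rw [sub_sq, mul_pow, sq_abs]
      ring
    simp_rw [this]
    have h4 := h2.const_mul (s ^ 2)
    have h5 := h1.const_mul (2 * s * I)
    rw [integral_add (f := fun x => s ^ 2 * u x ^ 2 - 2 * s * I * |u x|) (h4.sub h5)
      (integrable_const _), integral_sub h4 h5, integral_const_mul, integral_const_mul,
      integral_const, ← hI, ← hs, smul_eq_mul]
    ring
  have h4 : 0 ≤ s * (s * (∫ x, u x ^ 2 ∂μ) - I ^ 2) := by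
    rw [← h3]
    exact integral_nonneg fun x => sq_nonneg _
  rcases hs0.eq_or_lt with h0 | h0
  · have : μ = 0 := by
      rw [← Measure.measure_univ_eq_zero]
      exact (measureReal_eq_zero_iff).1 h0.symm
    simp [hI, this]
  · have := nonneg_of_mul_nonneg_right h4 h0
    linarith

/-! ### Curves which are continuous in `L²` -/

/-- A curve `t ↦ U(·, t)`, `0 ≤ t ≤ T`, which is continuous in `L²(0, L)`. -/
structure IsL2Curve (L T : ℝ) (U : ℝ → ℝ → ℝ) : Prop where
  memLp : ∀ t ∈ Icc 0 T, MemLp (fun y => U y t) 2 (volume.restrict (Ioo 0 L))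
  tendsto : ∀ t ∈ Icc 0 T, Tendsto (fun s => ∫ y in (0 : ℝ)..L, (U y s - U y t) ^ 2)
    (𝓝[Icc 0 T] t) (𝓝 0)

/-- The part of `(0, L)` at distance less than `2 * ε` from the endpoints. -/
def boundaryStrip (L ε : ℝ) : Set ℝ := Ioo 0 L ∩ (Iio (2 * ε) ∪ Ioi (L - 2 * ε))

lemma measurableSet_boundaryStrip (L ε : ℝ) : MeasurableSet (boundaryStrip L ε) :=
  measurableSet_Ioo.inter (measurableSet_Iio.union measurableSet_Ioi)

lemma measureReal_boundaryStrip_le {L ε : ℝ} (hε : 0 < ε) :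
    volume.real (boundaryStrip L ε) ≤ 4 * ε := by
  have hsub : boundaryStrip L ε ⊆ Icc 0 (2 * ε) ∪ Icc (L - 2 * ε) L := by
    rintro y ⟨⟨h0, hL⟩, h | h⟩
    · exact Or.inl ⟨h0.le, le_of_lt h⟩
    · exact Or.inr ⟨le_of_lt h, hL.le⟩
  calc volume.real (boundaryStrip L ε)
      ≤ volume.real (Icc 0 (2 * ε) ∪ Icc (L - 2 * ε) L) :=
        measureReal_mono hsub
          ((isCompact_Icc.union isCompact_Icc).measure_lt_top.ne)
    _ ≤ volume.real (Icc 0 (2 * ε)) + volume.real (Icc (L - 2 * ε) L) := measureReal_union_le _ _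
    _ = 4 * ε := by
        rw [Real.volume_real_Icc_of_le (by linarith), Real.volume_real_Icc_of_le (by linarith)]
        ring

namespace IsL2Curve

variable {L T : ℝ} {U : ℝ → ℝ → ℝ}

lemma intervalIntegrable (hU : IsL2Curve L T U) (hL : 0 < L) {t : ℝ} (ht : t ∈ Icc 0 T) :
    IntervalIntegrable (fun y => U y t) volume 0 L := by
  rw [intervalIntegrable_iff_integrableOn_Ioo_of_le hL.le]
  exact (hU.memLp t ht).integrable (by norm_num)

lemma intervalIntegrable_mul (hU : IsL2Curve L T U) (hL : 0 < L) {t : ℝ} (ht : t ∈ Icc 0 T)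
    {w : ℝ → ℝ} (hw : Continuous w) : IntervalIntegrable (fun y => U y t * w y) volume 0 L :=
  (hU.intervalIntegrable hL ht).mul_continuousOn hw.continuousOn

lemma integral_abs_sub_tendsto (hU : IsL2Curve L T U) (hL : 0 < L) {t : ℝ} (ht : t ∈ Icc 0 T) :
    Tendsto (fun s => ∫ y in (0 : ℝ)..L, |U y s - U y t|) (𝓝[Icc 0 T] t) (𝓝 0) := by
  have h := ((hU.tendsto t ht).const_mul L).sqrt
  rw [mul_zero, Real.sqrt_zero] at h
  refine squeeze_zero' (Eventually.of_forall fun s =>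
    intervalIntegral.integral_nonneg hL.le fun _ _ => abs_nonneg _) ?_ h
  filter_upwards [self_mem_nhdsWithin] with s hs
  apply Real.le_sqrt_of_sq_le
  have := sq_integral_abs_le ((hU.memLp s hs).sub (hU.memLp t ht))
  simp only [Pi.sub_apply] at this
  rw [measureReal_restrict_apply_univ, Real.volume_real_Ioo_of_le hL.le, sub_zero] at this
  rwa [intervalIntegral.integral_of_le hL.le, intervalIntegral.integral_of_le hL.le,
    integral_Ioc_eq_integral_Ioo, integral_Ioc_eq_integral_Ioo]

/-- The pairing of an `L²`-continuous curve with a continuous weight is continuous in time. -/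
lemma continuousOn_integral_mul (hU : IsL2Curve L T U) (hL : 0 < L) {w : ℝ → ℝ → ℝ}
    (hw : Continuous fun p : ℝ × ℝ => w p.1 p.2) :
    ContinuousOn (fun t => ∫ y in (0 : ℝ)..L, U y t * w y t) (Icc 0 T) := by
  intro t ht
  have hwt : ∀ s, Continuous fun y => w y s := fun s => by fun_prop
  obtain ⟨K, hK⟩ := (isCompact_Icc.prod (isCompact_Icc (a := (0 : ℝ)) (b := T))).exists_bound_of_continuousOn
    (s := Icc (0 : ℝ) L ×ˢ Icc 0 T) hw.continuousOn
  have hK' : ∀ y ∈ Icc 0 L, ∀ s ∈ Icc 0 T, |w y s| ≤ K := fun y hy s hs => hK (y, s) ⟨hy, hs⟩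
  have hIoc : ∀ {y}, y ∈ uIoc 0 L → y ∈ Icc 0 L := fun {y} hy => by
    rw [uIoc_of_le hL.le] at hy
    exact Ioc_subset_Icc_self hy
  -- The increment of the pairing is split: here the curve moves against a bounded weight, and in
  -- `h2` the weight moves with the curve frozen, by dominated convergence.
  have h1 : Tendsto (fun s => ∫ y in (0 : ℝ)..L, (U y s - U y t) * w y s) (𝓝[Icc 0 T] t) (𝓝 0) := by
    have hlim := (hU.integral_abs_sub_tendsto hL ht).mul_const K
    rw [zero_mul] at hlim
    refine squeeze_zero_norm' ?_ hlim
    filter_upwards [self_mem_nhdsWithin] with s hs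
    rw [← intervalIntegral.integral_mul_const]
    refine intervalIntegral.norm_integral_le_of_norm_le hL.le (ae_of_all _ fun y hy => ?_)
      ((((hU.intervalIntegrable hL hs).sub (hU.intervalIntegrable hL ht)).abs).mul_const K)
    rw [norm_mul, Real.norm_eq_abs, Real.norm_eq_abs]
    exact mul_le_mul_of_nonneg_left (hK' y (Ioc_subset_Icc_self hy) s hs) (abs_nonneg _)
  have h2 : Tendsto (fun s => ∫ y in (0 : ℝ)..L, U y t * w y s) (𝓝[Icc 0 T] t)
      (𝓝 (∫ y in (0 : ℝ)..L, U y t * w y t)) := by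
    refine intervalIntegral.tendsto_integral_filter_of_dominated_convergence
      (fun y => |U y t| * K) ?_ ?_ (((hU.intervalIntegrable hL ht).abs).mul_const K) ?_
    · refine Eventually.of_forall fun s => ?_
      exact (hU.intervalIntegrable_mul hL ht (hwt s)).aestronglyMeasurable_restrict_uIoc
    · filter_upwards [self_mem_nhdsWithin] with s hs
      refine ae_of_all _ fun y hy => ?_
      rw [norm_mul, Real.norm_eq_abs, Real.norm_eq_abs]
      exact mul_le_mul_of_nonneg_left (hK' y (hIoc hy) s hs) (abs_nonneg _)
    · refine ae_of_all _ fun y _ => Tendsto.mono_left ?_ nhdsWithin_le_nhds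
      have : Continuous fun s => U y t * w y s := by fun_prop
      exact this.tendsto t
  have h3 := h1.add h2
  rw [zero_add] at h3
  refine h3.congr' ?_
  filter_upwards [self_mem_nhdsWithin] with s hs
  rw [← intervalIntegral.integral_add]
  · congr 1; ext y; ring
  · exact ((hU.intervalIntegrable hL hs).sub (hU.intervalIntegrable hL ht)).mul_continuousOn
      (hwt s).continuousOn
  · exact hU.intervalIntegrable_mul hL ht (hwt s)

/-- Continuity gives a local bound through `a² ≤ 2 (a - b)² + 2 b²`, and compactness of `[0, T]`
makes it uniform. -/
lemma exists_integral_sq_le (hU : IsL2Curve L T U) (hL : 0 < L) :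
    ∃ M, ∀ t ∈ Icc 0 T, ∫ y in (0 : ℝ)..L, U y t ^ 2 ≤ M := by
  refine isCompact_Icc.induction_on (p := fun s => ∃ M, ∀ t ∈ s, ∫ y in (0 : ℝ)..L, U y t ^ 2 ≤ M)
    ⟨0, by simp⟩ (fun s t hst ⟨M, hM⟩ => ⟨M, fun x hx => hM x (hst hx)⟩)
    (fun s t ⟨M, hM⟩ ⟨N, hN⟩ => ⟨max M N, fun x hx => ?_⟩) fun t ht => ?_
  · rcases hx with hx | hx
    · exact (hM x hx).trans (le_max_left _ _)
    · exact (hN x hx).trans (le_max_right _ _)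
  · refine ⟨{s | s ∈ Icc 0 T ∧ ∫ y in (0 : ℝ)..L, (U y s - U y t) ^ 2 < 1},
      inter_mem self_mem_nhdsWithin ((hU.tendsto t ht).eventually_lt_const one_pos),
      2 + 2 * ∫ y in (0 : ℝ)..L, U y t ^ 2, ?_⟩
    rintro s ⟨hs, hs1⟩
    have hsq : ∀ {u : ℝ → ℝ}, MemLp u 2 (volume.restrict (Ioo 0 L)) →
        IntervalIntegrable (fun y => u y ^ 2) volume 0 L := fun hu => by
      rw [intervalIntegrable_iff_integrableOn_Ioo_of_le hL.le]
      exact hu.integrable_sq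
    have hd := hsq ((hU.memLp s hs).sub (hU.memLp t ht))
    have ht' := hsq (hU.memLp t ht)
    simp only [Pi.sub_apply] at hd
    calc ∫ y in (0 : ℝ)..L, U y s ^ 2
        ≤ ∫ y in (0 : ℝ)..L, (2 * (U y s - U y t) ^ 2 + 2 * U y t ^ 2) := by
          refine intervalIntegral.integral_mono_on hL.le (hsq (hU.memLp s hs))
            ((hd.const_mul 2).add (ht'.const_mul 2)) fun y _ => ?_
          nlinarith [sq_nonneg (U y s - 2 * U y t)]
      _ = 2 * (∫ y in (0 : ℝ)..L, (U y s - U y t) ^ 2) + 2 * ∫ y in (0 : ℝ)..L, U y t ^ 2 := by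
          rw [intervalIntegral.integral_add (hd.const_mul 2) (ht'.const_mul 2),
            intervalIntegral.integral_const_mul, intervalIntegral.integral_const_mul]
      _ ≤ _ := by linarith

lemma integrableOn_abs_boundaryStrip (hU : IsL2Curve L T U) {t : ℝ} (ht : t ∈ Icc 0 T) (ε : ℝ) :
    IntegrableOn (fun y => |U y t|) (boundaryStrip L ε) :=
  IntegrableOn.mono_set ((hU.memLp t ht).integrable (by norm_num)).abs inter_subset_left

/-- Cauchy-Schwarz on a set of measure at most `4 ε`, with the uniform `L²` bound. This is the
source of every factor `√ε` in the cutoff estimates. -/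
lemma exists_integral_boundaryStrip_le (hU : IsL2Curve L T U) (hL : 0 < L) :
    ∃ M, 0 ≤ M ∧ ∀ t ∈ Icc 0 T, ∀ ε > 0, ∫ y in boundaryStrip L ε, |U y t| ≤ M * √ε := by
  obtain ⟨M, hM⟩ := hU.exists_integral_sq_le hL
  refine ⟨√(4 * M), Real.sqrt_nonneg _, fun t ht ε hε => ?_⟩
  have hm := hU.memLp t ht
  have hM0 : 0 ≤ M := (intervalIntegral.integral_nonneg hL.le fun _ _ => sq_nonneg _).trans (hM t ht)
  rw [← Real.sqrt_mul (by positivity)]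
  apply Real.le_sqrt_of_sq_le
  have hms : MemLp (fun y => U y t) 2 (volume.restrict (boundaryStrip L ε)) := hm.mono_measure (Measure.restrict_mono_set volume
    (inter_subset_left : boundaryStrip L ε ⊆ Ioo 0 L))
  have hfin : IsFiniteMeasure (volume.restrict (boundaryStrip L ε)) :=
    isFiniteMeasure_restrict.2 ((measure_mono inter_subset_left).trans_lt measure_Ioo_lt_top).ne
  refine (sq_integral_abs_le hms).trans ?_
  rw [measureReal_restrict_apply_univ]
  have h1 := measureReal_boundaryStrip_le (L := L) hε
  have h2 : ∫ y in boundaryStrip L ε, U y t ^ 2 ≤ M := by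
    refine le_trans ?_ (hM t ht)
    rw [intervalIntegral.integral_of_le hL.le, integral_Ioc_eq_integral_Ioo]
    exact setIntegral_mono_set hm.integrable_sq (ae_of_all _ fun _ => sq_nonneg _)
      inter_subset_left.eventuallyLE
  calc volume.real (boundaryStrip L ε) * ∫ y in boundaryStrip L ε, U y t ^ 2
      ≤ (4 * ε) * M := by
        apply mul_le_mul h1 h2 (integral_nonneg fun _ => sq_nonneg _) (by positivity)
    _ = 4 * M * ε := by ring

end IsL2Curve

/-! ### Conservation in the sense of distributions, and cutoff functions -/

/-- A function of one variable which is continuous on `[0, T]` and whose derivative vanishes in the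
sense of distributions is constant. -/
lemma eq_of_integral_deriv_mul_eq_zero {T : ℝ} (hT : 0 < T) {A : ℝ → ℝ}
    (hA : ContinuousOn A (Icc 0 T))
    (h : ∀ θ : ℝ → ℝ, ContDiff ℝ ∞ θ → HasCompactSupport θ → tsupport θ ⊆ Ioo 0 T →
      ∫ t in (0 : ℝ)..T, A t * deriv θ t = 0) :
    ∀ t ∈ Icc 0 T, A t = A 0 := by
  obtain ⟨c, hc⟩ := exists_ae_eq_const_of_integral_mul_deriv_eq_zero hT
    (hA.integrableOn_Icc.mono_set Ioo_subset_Icc_self) h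
  have heq : EqOn A (fun _ => c) (Icc 0 T) := by
    refine Measure.eqOn_Icc_of_ae_eq (μ := volume) hT.ne ?_ hA continuousOn_const
    rw [← restrict_Ioo_eq_restrict_Icc]
    exact (ae_restrict_iff' measurableSet_Ioo).2 hc
  intro t ht
  rw [heq ht, heq (left_mem_Icc.2 hT.le)]

/-- Compactness bounds the derivative on `[0, 1]`; outside, the function attains its minimum `0` or
its maximum `1`, so the derivative vanishes. -/
lemma exists_abs_deriv_smoothTransition_le : ∃ C, 0 ≤ C ∧ ∀ x, |deriv Real.smoothTransition x| ≤ C := by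
  have hcont : Continuous (deriv Real.smoothTransition) :=
    (Real.smoothTransition.contDiff (n := 1)).continuous_deriv le_rfl
  obtain ⟨C, hC⟩ := (isCompact_Icc (a := (0 : ℝ)) (b := 1)).exists_bound_of_continuousOn
    hcont.continuousOn
  have hC0 : 0 ≤ C := (norm_nonneg _).trans (hC 0 (by simp))
  refine ⟨C, hC0, fun x => ?_⟩
  by_cases hx : x ∈ Icc 0 1
  · exact hC x hx
  · have : deriv Real.smoothTransition x = 0 := by
      rcases lt_or_ge x 0 with h | h
      · exact IsLocalMin.deriv_eq_zero (Eventually.of_forall fun z => by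
          rw [Real.smoothTransition.zero_of_nonpos h.le]
          exact Real.smoothTransition.nonneg z)
      · have h1 : 1 ≤ x := by
          by_contra! h'
          exact hx ⟨h, h'.le⟩
        exact IsLocalMax.deriv_eq_zero (Eventually.of_forall fun z => by
          rw [Real.smoothTransition.one_of_one_le h1]
          exact Real.smoothTransition.le_one z)
    rw [this, abs_zero]
    exact hC0

/-- Smooth cutoff functions of `(0, L)` with the natural bound of the derivative. -/
lemma exists_cutoff (L : ℝ) : ∃ C, 0 ≤ C ∧ ∀ ε > 0, ∃ χ : ℝ → ℝ, ContDiff ℝ ∞ χ ∧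
    HasCompactSupport χ ∧ tsupport χ ⊆ Ioo 0 L ∧ (∀ y, 0 ≤ χ y ∧ χ y ≤ 1) ∧
    (∀ y, |deriv χ y| ≤ C / ε) ∧
    (∀ y ∈ Ioo 0 L, y ∉ boundaryStrip L ε → χ y = 1 ∧ deriv χ y = 0) := by
  obtain ⟨C, hC0, hC⟩ := exists_abs_deriv_smoothTransition_le
  -- The cutoff is a product of two transitions, one per endpoint, each rising from distance `ε` to
  -- distance `2 * ε` with slope at most `C / ε`.
  refine ⟨2 * C, by positivity, fun ε hε => ?_⟩
  set σ := Real.smoothTransition with hσ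
  have hσd : ∀ x, HasDerivAt σ (deriv σ x) x := fun x =>
    ((Real.smoothTransition.contDiff (n := 1)).differentiable (by simp) x).hasDerivAt
  have hd : ∀ y, HasDerivAt (fun y => σ (y / ε - 1) * σ ((L - y) / ε - 1))
      (deriv σ (y / ε - 1) * (1 / ε) * σ ((L - y) / ε - 1)
        + σ (y / ε - 1) * (deriv σ ((L - y) / ε - 1) * (-1 / ε))) y := by
    intro y
    have h1 : HasDerivAt (fun y : ℝ => y / ε - 1) (1 / ε) y :=
      ((hasDerivAt_id y).div_const ε).sub_const 1
    have h2 : HasDerivAt (fun y : ℝ => (L - y) / ε - 1) (-1 / ε) y :=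
      (((hasDerivAt_id y).const_sub L).div_const ε).sub_const 1
    exact ((hσd _).comp y h1).mul ((hσd _).comp y h2)
  have h01 : ∀ x, 0 ≤ σ x ∧ σ x ≤ 1 := fun x =>
    ⟨Real.smoothTransition.nonneg x, Real.smoothTransition.le_one x⟩
  have hsupp : tsupport (fun y => σ (y / ε - 1) * σ ((L - y) / ε - 1)) ⊆ Icc ε (L - ε) := by
    refine closure_minimal (fun y hy => ?_) isClosed_Icc
    by_contra hy'
    apply hy
    rcases lt_or_ge y ε with h | h
    · have : σ (y / ε - 1) = 0 := Real.smoothTransition.zero_of_nonpos (by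
        rw [sub_nonpos, div_le_one hε]; exact h.le)
      simp [this]
    · have h' : L - y < ε := by
        by_contra! h'
        exact hy' ⟨h, by linarith⟩
      have : σ ((L - y) / ε - 1) = 0 := Real.smoothTransition.zero_of_nonpos (by
        rw [sub_nonpos, div_le_one hε]; exact h'.le)
      simp [this]
  refine ⟨fun y => σ (y / ε - 1) * σ ((L - y) / ε - 1), ?_, ?_, ?_, ?_, ?_, ?_⟩
  · have hs : ContDiff ℝ ∞ σ := Real.smoothTransition.contDiff
    exact (hs.comp ((contDiff_id.div_const ε).sub contDiff_const)).mul
      (hs.comp (((contDiff_const.sub contDiff_id).div_const ε).sub contDiff_const))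
  · exact HasCompactSupport.of_support_subset_isCompact isCompact_Icc (subset_closure.trans hsupp)
  · exact hsupp.trans (Icc_subset_Ioo hε (by linarith))
  · intro y
    exact ⟨mul_nonneg (h01 _).1 (h01 _).1, mul_le_one₀ (h01 _).2 (h01 _).1 (h01 _).2⟩
  · intro y
    rw [(hd y).deriv]
    have hb : ∀ x, |σ x| ≤ 1 := fun x => abs_le.2 ⟨by linarith [(h01 x).1], (h01 x).2⟩
    have e1 : |deriv σ (y / ε - 1) * (1 / ε) * σ ((L - y) / ε - 1)| ≤ C * (1 / ε) * 1 := by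
      rw [abs_mul, abs_mul, abs_of_pos (by positivity : 0 < 1 / ε)]
      gcongr
      · exact hC _
      · exact hb _
    have e2 : |σ (y / ε - 1) * (deriv σ ((L - y) / ε - 1) * (-1 / ε))| ≤ 1 * (C * (1 / ε)) := by
      rw [abs_mul, abs_mul, neg_div, abs_neg, abs_of_pos (by positivity : 0 < 1 / ε)]
      gcongr
      · exact hb _
      · exact hC _
    refine (abs_add_le _ _).trans ((add_le_add e1 e2).trans (le_of_eq ?_))
    ring
  · intro y hy hys
    have hd0 : ∀ x, 1 ≤ x → deriv σ x = 0 := by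
      intro x hx
      exact IsLocalMax.deriv_eq_zero (Eventually.of_forall fun z => by
        rw [hσ, Real.smoothTransition.one_of_one_le hx]
        exact Real.smoothTransition.le_one z)
    have hy1 : 2 * ε ≤ y := by
      by_contra! h
      exact hys ⟨hy, Or.inl h⟩
    have hy2 : y ≤ L - 2 * ε := by
      by_contra! h
      exact hys ⟨hy, Or.inr h⟩
    have g1 : 1 ≤ y / ε - 1 := by
      rw [le_sub_iff_add_le, le_div_iff₀ hε]; linarith
    have g2 : 1 ≤ (L - y) / ε - 1 := by
      rw [le_sub_iff_add_le, le_div_iff₀ hε]; linarith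
    constructor
    · simp only [hσ, Real.smoothTransition.one_of_one_le g1,
        Real.smoothTransition.one_of_one_le g2, mul_one]
    · rw [(hd y).deriv, hd0 _ g1, hd0 _ g2]
      simp

/-! ### Travelling waves which vanish on the moving boundary -/

lemma gam_pos {v : ℝ} (hv0 : 0 < v) (hv1 : v < 1) : 0 < gam v :=
  div_pos (by linarith) (by linarith)

lemma gam_mul_one_sub {v : ℝ} (hv1 : v < 1) : gam v * (1 - v) = 1 + v :=
  div_mul_cancel₀ _ (by linarith)

/-- In this form the period is the difference of the two phases of `waveDiff` at `y = L`. -/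
lemma L2_eq {v : ℝ} (hv1 : v < 1) (L : ℝ) : L2 v L = (1 + gam v) * L := by
  have : 1 - v ≠ 0 := by linarith
  rw [L2, gam]
  field_simp
  ring

/-- A smooth periodic profile `e` with its first two derivatives. -/
structure IsProfile (P K : ℝ) (e e1 e2 : ℝ → ℝ) : Prop where
  contDiff : ContDiff ℝ ∞ e
  contDiff_deriv : ContDiff ℝ ∞ e1
  continuous_deriv_two : Continuous e2
  hasDerivAt : ∀ s, HasDerivAt e (e1 s) s
  hasDerivAt_deriv : ∀ s, HasDerivAt e1 (e2 s) s
  periodic : Function.Periodic e P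
  abs_deriv_le : ∀ s, |e1 s| ≤ K

/-- The difference of two travelling waves with profile `e`, in the coordinate `y = x - v * t`. If
`e` has period `L2 v L`, it vanishes for `y = 0` and for `y = L`. -/
noncomputable def waveDiff (v : ℝ) (e : ℝ → ℝ) (y t : ℝ) : ℝ :=
  e (t + (y + v * t)) - e (gam v * (t - (y + v * t)))

/-- The time derivative of the travelling wave solution; `e1` is the derivative of its profile. -/
noncomputable def waveDiffT (v : ℝ) (e1 : ℝ → ℝ) (y t : ℝ) : ℝ :=
  e1 (t + (y + v * t)) - gam v * e1 (gam v * (t - (y + v * t)))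

/-- The space derivative of the travelling wave solution; `e1` is the derivative of its profile. -/
noncomputable def waveDiffX (v : ℝ) (e1 : ℝ → ℝ) (y t : ℝ) : ℝ :=
  e1 (t + (y + v * t)) + gam v * e1 (gam v * (t - (y + v * t)))

/-- The second derivatives of the travelling wave solution; `e2` is the second derivative of its
profile. -/
noncomputable def waveDiffXX (v : ℝ) (e2 : ℝ → ℝ) (y t : ℝ) : ℝ :=
  e2 (t + (y + v * t)) - gam v ^ 2 * e2 (gam v * (t - (y + v * t)))

lemma continuous_waveDiff (v : ℝ) {e : ℝ → ℝ} (he : Continuous e) :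
    Continuous fun p : ℝ × ℝ => waveDiff v e p.1 p.2 := by
  unfold waveDiff; fun_prop

lemma continuous_waveDiffT (v : ℝ) {e : ℝ → ℝ} (he : Continuous e) :
    Continuous fun p : ℝ × ℝ => waveDiffT v e p.1 p.2 := by
  unfold waveDiffT; fun_prop

lemma continuous_waveDiffX (v : ℝ) {e : ℝ → ℝ} (he : Continuous e) :
    Continuous fun p : ℝ × ℝ => waveDiffX v e p.1 p.2 := by
  unfold waveDiffX; fun_prop

lemma continuous_waveDiffXX (v : ℝ) {e : ℝ → ℝ} (he : Continuous e) :
    Continuous fun p : ℝ × ℝ => waveDiffXX v e p.1 p.2 := by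
  unfold waveDiffXX; fun_prop

namespace IsProfile

variable {v L K : ℝ} {e e1 e2 : ℝ → ℝ}

lemma bound_nonneg {P : ℝ} (he : IsProfile P K e e1 e2) : 0 ≤ K :=
  (abs_nonneg _).trans (he.abs_deriv_le 0)

lemma abs_sub_le {P : ℝ} (he : IsProfile P K e e1 e2) (r s : ℝ) : |e r - e s| ≤ K * |r - s| :=
  Convex.norm_image_sub_le_of_norm_hasDerivWithin_le (f := e) (f' := e1) (s := univ)
    (fun x _ => (he.hasDerivAt x).hasDerivWithinAt) (fun x _ => he.abs_deriv_le x) convex_univ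
    (mem_univ s) (mem_univ r)

/-- By `γ (1 - v) = 1 + v` the time terms of the two phases cancel in their difference, which is `(1
+ γ) y`. -/
lemma abs_waveDiff_le_left (he : IsProfile (L2 v L) K e e1 e2) (hv0 : 0 < v) (hv1 : v < 1)
    {y : ℝ} (hy : 0 ≤ y) (t : ℝ) : |waveDiff v e y t| ≤ K * (1 + gam v) * y := by
  have hg := gam_pos hv0 hv1
  refine (he.abs_sub_le _ _).trans (le_of_eq ?_)
  have : t + (y + v * t) - gam v * (t - (y + v * t)) = (1 + gam v) * y := by
    linear_combination (-t) * gam_mul_one_sub hv1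
  rw [this, abs_of_nonneg (by positivity), mul_assoc]

/-- Shifting the second phase by one period makes the phases agree at `y = L`. This is where the
choice of the period `L2 v L` matters. -/
lemma abs_waveDiff_le_right (he : IsProfile (L2 v L) K e e1 e2) (hv0 : 0 < v) (hv1 : v < 1)
    {y : ℝ} (hy : y ≤ L) (t : ℝ) : |waveDiff v e y t| ≤ K * (1 + gam v) * (L - y) := by
  have hg := gam_pos hv0 hv1
  rw [waveDiff, ← he.periodic (gam v * (t - (y + v * t)))]
  refine (he.abs_sub_le _ _).trans (le_of_eq ?_)
  have : t + (y + v * t) - (gam v * (t - (y + v * t)) + L2 v L) = -((1 + gam v) * (L - y)) := by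
    rw [L2_eq hv1]
    linear_combination (-t) * gam_mul_one_sub hv1
  rw [this, abs_neg, abs_of_nonneg (mul_nonneg (by positivity) (by linarith)), mul_assoc]

lemma abs_waveDiffT_le {P : ℝ} (he : IsProfile P K e e1 e2) (hv0 : 0 < v) (hv1 : v < 1)
    (y t : ℝ) : |waveDiffT v e1 y t| ≤ K * (1 + gam v) := by
  have hg := gam_pos hv0 hv1
  refine (abs_sub _ _).trans ?_
  rw [abs_mul, abs_of_pos hg]
  nlinarith [he.abs_deriv_le (t + (y + v * t)),
    mul_le_mul_of_nonneg_left (he.abs_deriv_le (gam v * (t - (y + v * t)))) hg.le]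

lemma abs_waveDiffX_le {P : ℝ} (he : IsProfile P K e e1 e2) (hv0 : 0 < v) (hv1 : v < 1)
    (y t : ℝ) : |waveDiffX v e1 y t| ≤ K * (1 + gam v) := by
  have hg := gam_pos hv0 hv1
  refine (abs_add_le _ _).trans ?_
  rw [abs_mul, abs_of_pos hg]
  nlinarith [he.abs_deriv_le (t + (y + v * t)),
    mul_le_mul_of_nonneg_left (he.abs_deriv_le (gam v * (t - (y + v * t)))) hg.le]

end IsProfile

/-! ### The weak formulation tested with cut-off travelling waves -/

lemma memLp_comp_add_right {a b : ℝ} (c : ℝ) {g : ℝ → ℝ}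
    (hg : MemLp g 2 (volume.restrict (Ioo (a + c) (b + c)))) :
    MemLp (fun y => g (y + c)) 2 (volume.restrict (Ioo a b)) := by
  have h := (measurePreserving_add_right volume c).restrict_preimage
    (measurableSet_Ioo (a := a + c) (b := b + c))
  rw [preimage_add_const_Ioo, add_sub_cancel_right, add_sub_cancel_right] at h
  exact hg.comp_measurePreserving h

/-- The cut-off products used as test functions. -/
lemma isTest_mul {v L T : ℝ} {θ χ : ℝ → ℝ} {G : ℝ × ℝ → ℝ} (hθ : ContDiff ℝ ∞ θ)
    (hθc : HasCompactSupport θ) (hθt : tsupport θ ⊆ Ioo 0 T) (hχ : ContDiff ℝ ∞ χ)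
    (hχc : HasCompactSupport χ) (hχt : tsupport χ ⊆ Ioo 0 L) (hG : ContDiff ℝ ∞ G) :
    IsTest v L T fun p => θ p.2 * χ (p.1 - v * p.2) * G p := by
  have hK : IsCompact ((fun q : ℝ × ℝ => (q.1 + v * q.2, q.2)) '' (tsupport χ ×ˢ tsupport θ)) :=
    (IsCompact.prod hχc hθc).image (by fun_prop)
  have hts : tsupport (fun p : ℝ × ℝ => θ p.2 * χ (p.1 - v * p.2) * G p) ⊆
      (fun q : ℝ × ℝ => (q.1 + v * q.2, q.2)) '' (tsupport χ ×ˢ tsupport θ) := by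
    refine closure_minimal (fun p hp => ?_) hK.isClosed
    have h1 : θ p.2 ≠ 0 := fun h => hp (by simp [h])
    have h2 : χ (p.1 - v * p.2) ≠ 0 := fun h => hp (by simp [h])
    exact ⟨(p.1 - v * p.2, p.2), ⟨subset_closure h2, subset_closure h1⟩, by simp⟩
  refine ⟨?_, HasCompactSupport.of_support_subset_isCompact hK (subset_closure.trans hts), ?_⟩
  · exact ((hθ.comp contDiff_snd).mul
      (hχ.comp (contDiff_fst.sub (contDiff_const.mul contDiff_snd)))).mul hG
  · refine hts.trans ?_
    rintro _ ⟨q, ⟨h1, h2⟩, rfl⟩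
    have h3 := hχt h1
    have h4 := hθt h2
    exact ⟨h4.1, h4.2, by simpa using h3.1, by simpa using h3.2⟩

/-- Three terms suffice for every derivative of the test functions; shorter sums are padded with `0
* 0`. -/
lemma integral_mul_linear {L : ℝ} {u w1 w2 w3 : ℝ → ℝ} (hu : IntervalIntegrable u volume 0 L)
    (h1 : Continuous w1) (h2 : Continuous w2) (h3 : Continuous w3) (a b c : ℝ) :
    ∫ y in (0 : ℝ)..L, u y * (a * w1 y + b * w2 y + c * w3 y)
      = a * (∫ y in (0 : ℝ)..L, u y * w1 y) + b * (∫ y in (0 : ℝ)..L, u y * w2 y)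
        + c * ∫ y in (0 : ℝ)..L, u y * w3 y := by
  have hi : ∀ {w : ℝ → ℝ}, Continuous w → ∀ a : ℝ,
      IntervalIntegrable (fun y => a * (u y * w y)) volume 0 L :=
    fun hw a => (hu.mul_continuousOn hw.continuousOn).const_mul a
  simp_rw [← intervalIntegral.integral_const_mul]
  rw [← intervalIntegral.integral_add (hi h1 a) (hi h2 b),
    ← intervalIntegral.integral_add ((hi h1 a).add (hi h2 b)) (hi h3 c)]
  congr 1; ext y; ring

lemma integral_translate (v L t : ℝ) (f : ℝ → ℝ) :
    ∫ x in (v * t)..(L + v * t), f x = ∫ y in (0 : ℝ)..L, f (y + v * t) := by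
  rw [intervalIntegral.integral_comp_add_right, zero_add]

namespace IsSolution

variable {v L T : ℝ} {φ0 φ1 : ℝ → ℝ} {φ φx φt : ℝ → ℝ → ℝ}

lemma isL2Curve_x (hφ : IsSolution v L T φ0 φ1 φ φx φt) :
    IsL2Curve L T fun y t => φx (y + v * t) t :=
  ⟨fun t ht => memLp_comp_add_right (v * t) (g := fun x => φx x t)
    (by rw [zero_add]; exact (hφ.isH10 t ht).memLp_deriv), hφ.continuous_x⟩

lemma isL2Curve_t (hφ : IsSolution v L T φ0 φ1 φ φx φt) :
    IsL2Curve L T fun y t => φt (y + v * t) t :=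
  ⟨fun t ht => memLp_comp_add_right (v * t) (g := fun x => φt x t)
    (by rw [zero_add]; exact hφ.memLp_t t ht), hφ.continuous_t⟩

lemma isL2Curve (hφ : IsSolution v L T φ0 φ1 φ φx φt) :
    IsL2Curve L T fun y t => φ (y + v * t) t := by
  refine ⟨fun t ht => memLp_comp_add_right (v * t) (g := fun x => φ x t) ?_, hφ.continuous⟩
  rw [zero_add]
  have hc := (hφ.isH10 t ht).continuousOn
  obtain ⟨C, hC⟩ := isCompact_Icc.exists_bound_of_continuousOn hc
  refine MemLp.of_bound ?_ C ?_
  · exact (hc.mono Ioo_subset_Icc_self).aestronglyMeasurable measurableSet_Ioo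
  · exact (ae_restrict_iff' measurableSet_Ioo).2
      (ae_of_all _ fun x hx => hC x (Ioo_subset_Icc_self hx))

/-- The point `y` is reached from the nearer endpoint by integrating `φx`, without leaving the
strip. Since `φ` vanishes at both endpoints, `φ` is then `O(√ε)` on the strip, which is needed
against cutoff derivatives of size `1 / ε`. -/
lemma abs_le_integral_boundaryStrip (hφ : IsSolution v L T φ0 φ1 φ φx φt) (hL : 0 < L) {t : ℝ}
    (ht : t ∈ Icc 0 T) {ε y : ℝ} (hy : y ∈ boundaryStrip L ε) :
    |φ (y + v * t) t| ≤ ∫ z in boundaryStrip L ε, |φx (z + v * t) t| := by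
  have hH := hφ.isH10 t ht
  have hlt : v * t < L + v * t := by linarith
  have hint := hφ.isL2Curve_x.intervalIntegrable hL ht
  have heq : φ (y + v * t) t = ∫ z in (0 : ℝ)..y, φx (z + v * t) t := by
    rw [hH.eq_integral hlt ⟨by linarith [hy.1.1], by linarith [hy.1.2]⟩,
      intervalIntegral.integral_comp_add_right (fun z => φx z t), zero_add]
  have hzero : ∫ z in (0 : ℝ)..L, φx (z + v * t) t = 0 := by
    rw [← integral_translate v L t (fun z => φx z t), hH.integral_deriv_eq_zero hlt]
  have hstrip := hφ.isL2Curve_x.integrableOn_abs_boundaryStrip ht ε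
  have hmono : ∀ {a b : ℝ}, a ≤ b → Ioo a b ⊆ boundaryStrip L ε →
      |∫ z in a..b, φx (z + v * t) t| ≤ ∫ z in boundaryStrip L ε, |φx (z + v * t) t| := by
    intro a b hab hsub
    refine (intervalIntegral.abs_integral_le_integral_abs hab).trans ?_
    rw [intervalIntegral.integral_of_le hab, integral_Ioc_eq_integral_Ioo]
    exact setIntegral_mono_set hstrip (ae_of_all _ fun _ => abs_nonneg _) hsub.eventuallyLE
  rcases hy with ⟨⟨h0, h1⟩, h | h⟩
  · rw [heq]
    exact hmono h0.le fun z hz => ⟨⟨hz.1, hz.2.trans h1⟩, Or.inl (hz.2.trans h)⟩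
  · have hsplit := intervalIntegral.integral_add_adjacent_intervals
      (hint.mono_set (uIcc_subset_uIcc left_mem_uIcc (by rw [uIcc_of_le hL.le]; exact ⟨h0.le, h1.le⟩)))
      (hint.mono_set (uIcc_subset_uIcc (by rw [uIcc_of_le hL.le]; exact ⟨h0.le, h1.le⟩)
        right_mem_uIcc : uIcc y L ⊆ uIcc 0 L))
    rw [hzero] at hsplit
    rw [heq, eq_neg_of_add_eq_zero_left hsplit, abs_neg]
    exact hmono h1.le fun z hz => ⟨⟨h0.trans hz.1, hz.2⟩, Or.inr (lt_trans h hz.1)⟩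

/-- The weak formulations, tested with the product of two cutoff functions and a travelling wave
solution. -/
lemma integral_cutoff_eq_zero (hφ : IsSolution v L T φ0 φ1 φ φx φt) (hL : 0 < L) (hT : 0 < T)
    {P K : ℝ} {e e1 e2 : ℝ → ℝ} (he : IsProfile P K e e1 e2) {θ χ : ℝ → ℝ} (hθ : ContDiff ℝ ∞ θ)
    (hθc : HasCompactSupport θ) (hθt : tsupport θ ⊆ Ioo 0 T) (hχ : ContDiff ℝ ∞ χ)
    (hχc : HasCompactSupport χ) (hχt : tsupport χ ⊆ Ioo 0 L) :
    ∫ t in (0 : ℝ)..T,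
      (deriv θ t * ((∫ y in (0 : ℝ)..L, φt (y + v * t) t * (χ y * waveDiff v e y t))
          - ∫ y in (0 : ℝ)..L, φ (y + v * t) t * (χ y * waveDiffT v e1 y t))
        + θ t * ((∫ y in (0 : ℝ)..L, φ (y + v * t) t *
              (deriv χ y * (v * waveDiffT v e1 y t + waveDiffX v e1 y t)))
          - v * (∫ y in (0 : ℝ)..L, φt (y + v * t) t * (deriv χ y * waveDiff v e y t))
          - ∫ y in (0 : ℝ)..L, φx (y + v * t) t * (deriv χ y * waveDiff v e y t))) = 0 := by
  have hW := continuous_waveDiff v he.contDiff.continuous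
  have hWt := continuous_waveDiffT v he.contDiff_deriv.continuous
  have hWx := continuous_waveDiffX v he.contDiff_deriv.continuous
  have hWxx := continuous_waveDiffXX v he.continuous_deriv_two
  have hχ0 := hχ.continuous
  have hχ1 : Continuous (deriv χ) := hχ.continuous_deriv (by simp)
  have hθ0 := hθ.continuous
  have hθ1 : Continuous (deriv θ) := hθ.continuous_deriv (by simp)
  have hθd : ∀ t, HasDerivAt θ (deriv θ t) t := fun t =>
    (hθ.differentiable (by simp) t).hasDerivAt
  have hχd : ∀ t, HasDerivAt χ (deriv χ t) t := fun t =>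
    (hχ.differentiable (by simp) t).hasDerivAt
  -- partial derivatives of the test functions
  have hPT : ∀ (G : ℝ × ℝ → ℝ) (x t g : ℝ), HasDerivAt (fun s => G (x, s)) g t →
      partialT (fun p => θ p.2 * χ (p.1 - v * p.2) * G p) x t
        = deriv θ t * (χ (x - v * t) * G (x, t)) + (-v * θ t) * (deriv χ (x - v * t) * G (x, t))
          + θ t * (χ (x - v * t) * g) := by
    intro G x t g hg
    have h1 : HasDerivAt (fun s => x - v * s) (-v) t := by
      simpa using ((hasDerivAt_id t).const_mul v).const_sub x
    have h2 := ((hθd t).mul ((hχd (x - v * t)).comp t h1)).mul hg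
    refine h2.deriv.trans ?_
    simp only [Function.comp, Pi.mul_apply]
    ring
  have hPX : ∀ (G : ℝ × ℝ → ℝ) (x t g : ℝ), HasDerivAt (fun z => G (z, t)) g x →
      partialX (fun p => θ p.2 * χ (p.1 - v * p.2) * G p) x t
        = θ t * (deriv χ (x - v * t) * G (x, t)) + θ t * (χ (x - v * t) * g) + 0 * 0 := by
    intro G x t g hg
    have h1 : HasDerivAt (fun z => z - v * t) 1 x := (hasDerivAt_id x).sub_const _
    have h2 := (((hχd (x - v * t)).comp x h1).const_mul (θ t)).mul hg
    refine h2.deriv.trans ?_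
    simp only [Function.comp]
    ring
  -- the travelling wave in the original coordinates
  have hg1 : ∀ (x t : ℝ), HasDerivAt (fun s => gam v * (s - x)) (gam v) t := fun x t => by
    simpa using ((hasDerivAt_id t).sub_const x).const_mul (gam v)
  have hg2 : ∀ (x t : ℝ), HasDerivAt (fun z => gam v * (t - z)) (-gam v) x := fun x t => by
    simpa using ((hasDerivAt_id x).const_sub t).const_mul (gam v)
  have hp1 : ∀ (x t : ℝ), HasDerivAt (fun s => s + x) 1 t := fun x t => (hasDerivAt_id t).add_const x
  have hp2 : ∀ (x t : ℝ), HasDerivAt (fun z => t + z) 1 x := fun x t => (hasDerivAt_id x).const_add t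
  set Ψ : ℝ × ℝ → ℝ := fun p => e (p.2 + p.1) - e (gam v * (p.2 - p.1)) with hΨ
  set Ψt : ℝ × ℝ → ℝ := fun p => e1 (p.2 + p.1) - gam v * e1 (gam v * (p.2 - p.1)) with hΨt
  have hΨs : ContDiff ℝ ∞ Ψ := (he.contDiff.comp (contDiff_snd.add contDiff_fst)).sub
    (he.contDiff.comp (contDiff_const.mul (contDiff_snd.sub contDiff_fst)))
  have hΨts : ContDiff ℝ ∞ Ψt := (he.contDiff_deriv.comp (contDiff_snd.add contDiff_fst)).sub
    (contDiff_const.mul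
      (he.contDiff_deriv.comp (contDiff_const.mul (contDiff_snd.sub contDiff_fst))))
  have hdT : ∀ x t, HasDerivAt (fun s => Ψ (x, s)) (Ψt (x, t)) t := by
    intro x t
    refine (((he.hasDerivAt _).comp t (hp1 x t)).sub
      ((he.hasDerivAt _).comp t (hg1 x t))).congr_deriv ?_
    simp only [hΨt]
    ring
  have hdX : ∀ x t, HasDerivAt (fun z => Ψ (z, t))
      (e1 (t + x) + gam v * e1 (gam v * (t - x))) x := by
    intro x t
    refine (((he.hasDerivAt _).comp x (hp2 x t)).sub
      ((he.hasDerivAt _).comp x (hg2 x t))).congr_deriv ?_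
    ring
  have hdTT : ∀ x t, HasDerivAt (fun s => Ψt (x, s))
      (e2 (t + x) - gam v ^ 2 * e2 (gam v * (t - x))) t := by
    intro x t
    refine (((he.hasDerivAt_deriv _).comp t (hp1 x t)).sub
      (((he.hasDerivAt_deriv _).comp t (hg1 x t)).const_mul (gam v))).congr_deriv ?_
    ring
  have hU := hφ.isL2Curve
  have hUt := hφ.isL2Curve_t
  have hUx := hφ.isL2Curve_x
  -- The wave equation is tested with the cut-off wave `Ψ`, and the definition of `φt` with the
  -- cut-off velocity `Ψt`; together they replace Green's identity.
  have hwave := hφ.wave _ (isTest_mul (v := v) hθ hθc hθt hχ hχc hχt hΨs)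
  have hweak := hφ.weak_deriv_t _ (isTest_mul (v := v) hθ hθc hθt hχ hχc hχt hΨts)
  simp_rw [hPT Ψ _ _ _ (hdT _ _), hPX Ψ _ _ _ (hdX _ _), integral_translate,
    add_sub_cancel_right] at hwave
  simp_rw [hPT Ψt _ _ _ (hdTT _ _), integral_translate, add_sub_cancel_right] at hweak
  have hfix : ∀ {w : ℝ → ℝ → ℝ} {g : ℝ → ℝ}, Continuous g →
      (Continuous fun p : ℝ × ℝ => w p.1 p.2) → ∀ t, Continuous fun y => g y * w y t :=
    fun hg hw t => hg.mul (hw.comp (by fun_prop : Continuous fun y => (y, t)))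
  have hpair : ∀ {u w : ℝ → ℝ → ℝ} {g : ℝ → ℝ}, IsL2Curve L T u → Continuous g →
      (Continuous fun p : ℝ × ℝ => w p.1 p.2) →
      ∃ A : ℝ → ℝ, (∀ t, ∫ y in (0 : ℝ)..L, u y t * (g y * w y t) = A t) ∧
        ContinuousOn A (Icc 0 T) :=
    fun {u w g} hu hg hw => ⟨_, fun _ => rfl, hu.continuousOn_integral_mul hL
      (w := fun y t => g y * w y t) ((hg.comp continuous_fst).mul hw)⟩
  obtain ⟨a1, ha1, ca1⟩ := hpair hUt hχ0 hW
  obtain ⟨a2, ha2, ca2⟩ := hpair hUt hχ1 hW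
  obtain ⟨a3, ha3, ca3⟩ := hpair hUt hχ0 hWt
  obtain ⟨b1, hb1, cb1⟩ := hpair hUx hχ1 hW
  obtain ⟨b2, hb2, cb2⟩ := hpair hUx hχ0 hWx
  obtain ⟨c1, hc1, cc1⟩ := hpair hU hχ0 hWt
  obtain ⟨c2, hc2, cc2⟩ := hpair hU hχ1 hWt
  obtain ⟨c3, hc3, cc3⟩ := hpair hU hχ0 hWxx
  obtain ⟨c4, hc4, cc4⟩ := hpair hU hχ1 hWx
  have hIcc : ∀ {t}, t ∈ uIcc 0 T → t ∈ Icc 0 T := fun {t} ht => by rwa [uIcc_of_le hT.le] at ht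
  have h1 : ∫ t in (0 : ℝ)..T, (deriv θ t * a1 t + (-v * θ t) * a2 t + θ t * a3 t
      - (θ t * b1 t + θ t * b2 t)) = 0 := by
    refine Eq.trans ?_ hwave
    refine intervalIntegral.integral_congr fun t ht => ?_
    have ht' := hIcc ht
    have e1 := integral_mul_linear (hUt.intervalIntegrable hL ht') (hfix hχ0 hW t)
      (hfix hχ1 hW t) (hfix hχ0 hWt t) (deriv θ t) (-v * θ t) (θ t)
    have e2 := integral_mul_linear (hUx.intervalIntegrable hL ht') (hfix hχ1 hW t)
      (hfix hχ0 hWx t) (continuous_const (y := (0 : ℝ))) (θ t) (θ t) 0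
    rw [ha1, ha2, ha3] at e1
    rw [hb1, hb2] at e2
    have e2' := e2.trans (show _ = θ t * b1 t + θ t * b2 t by ring)
    rw [← e1, ← e2', ← intervalIntegral.integral_sub]
    · rfl
    · exact hUt.intervalIntegrable_mul hL ht' (((continuous_const.mul (hfix hχ0 hW t)).add
        (continuous_const.mul (hfix hχ1 hW t))).add
        (continuous_const.mul (hfix hχ0 hWt t)))
    · exact hUx.intervalIntegrable_mul hL ht' (((continuous_const.mul (hfix hχ1 hW t)).add
        (continuous_const.mul (hfix hχ0 hWx t))).add
        (continuous_const.mul continuous_const))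
  have h2 : ∫ t in (0 : ℝ)..T, (deriv θ t * c1 t + (-v * θ t) * c2 t + θ t * c3 t)
      = -∫ t in (0 : ℝ)..T, θ t * a3 t := by
    have hl : ∫ t in (0 : ℝ)..T, (deriv θ t * c1 t + (-v * θ t) * c2 t + θ t * c3 t)
        = ∫ t in (0 : ℝ)..T, ∫ y in (0 : ℝ)..L, φ (y + v * t) t *
          (deriv θ t * (χ y * waveDiffT v e1 y t) + (-v * θ t) * (deriv χ y * waveDiffT v e1 y t)
            + θ t * (χ y * waveDiffXX v e2 y t)) := by
      refine intervalIntegral.integral_congr fun t ht => ?_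
      rw [integral_mul_linear (hU.intervalIntegrable hL (hIcc ht)) (hfix hχ0 hWt t)
        (hfix hχ1 hWt t) (hfix hχ0 hWxx t), hc1, hc2, hc3]
    have hr : ∫ t in (0 : ℝ)..T, θ t * a3 t = ∫ t in (0 : ℝ)..T, ∫ y in (0 : ℝ)..L,
        φt (y + v * t) t * (θ t * χ y * waveDiffT v e1 y t) := by
      refine intervalIntegral.integral_congr fun t _ => ?_
      rw [← ha3, ← intervalIntegral.integral_const_mul]
      congr 1; ext y; ring
    rw [hl, hr]
    exact hweak
  -- Integration by parts in space. The term `c3` is the same as in `h2` because the second space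
  -- and time derivatives of the wave coincide.
  have h3 : ∀ t ∈ Icc 0 T, b2 t = -(c4 t + c3 t) := by
    intro t ht
    have hd : ∀ x, HasDerivAt
        (fun x => χ (x - v * t) * (e1 (t + x) + gam v * e1 (gam v * (t - x))))
        (1 * (deriv χ (x - v * t) * (e1 (t + x) + gam v * e1 (gam v * (t - x))))
          + 1 * (χ (x - v * t) * (e2 (t + x) - gam v ^ 2 * e2 (gam v * (t - x)))) + 0 * 0) x := by
      intro x
      have h1 : HasDerivAt (fun z => z - v * t) 1 x := (hasDerivAt_id x).sub_const _
      refine (((hχd (x - v * t)).comp x h1).mul (((he.hasDerivAt_deriv _).comp x (hp2 x t)).add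
        (((he.hasDerivAt_deriv _).comp x (hg2 x t)).const_mul (gam v)))).congr_deriv ?_
      simp only [Function.comp, Pi.add_apply]
      ring
    have hcd := he.contDiff_deriv.continuous
    have hcd2 := he.continuous_deriv_two
    have := (hφ.isH10 t ht).integral_deriv_mul (by linarith) hd (by fun_prop)
    simp_rw [integral_translate, add_sub_cancel_right] at this
    have e3 := integral_mul_linear (hU.intervalIntegrable hL ht) (hfix hχ1 hWx t)
      (hfix hχ0 hWxx t) (continuous_const (y := (0 : ℝ))) 1 1 0
    rw [hc4, hc3] at e3
    rw [← hb2]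
    exact this.trans (congrArg Neg.neg (e3.trans (by ring)))
  have hsum : ∀ t, ∫ y in (0 : ℝ)..L, φ (y + v * t) t *
      (deriv χ y * (v * waveDiffT v e1 y t + waveDiffX v e1 y t)) =
      ∫ y in (0 : ℝ)..L, φ (y + v * t) t * (v * (deriv χ y * waveDiffT v e1 y t)
        + 1 * (deriv χ y * waveDiffX v e1 y t) + 0 * 0) := by
    intro t
    congr 1; ext y; ring
  have h4 : ∀ t ∈ Icc 0 T, ∫ y in (0 : ℝ)..L, φ (y + v * t) t *
      (deriv χ y * (v * waveDiffT v e1 y t + waveDiffX v e1 y t)) = v * c2 t + c4 t := by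
    intro t ht
    rw [hsum, integral_mul_linear (hU.intervalIntegrable hL ht) (hfix hχ1 hWt t)
      (hfix hχ1 hWx t) continuous_const, hc2, hc4]
    ring
  have hθ0' := hθ0.continuousOn (s := Icc 0 T)
  have hθ1' := hθ1.continuousOn (s := Icc 0 T)
  have i1 : IntervalIntegrable (fun t => deriv θ t * a1 t + (-v * θ t) * a2 t + θ t * a3 t
      - (θ t * b1 t + θ t * b2 t)) volume 0 T :=
    ContinuousOn.intervalIntegrable_of_Icc hT.le (by fun_prop)
  have i2 : IntervalIntegrable
      (fun t => deriv θ t * c1 t + (-v * θ t) * c2 t + θ t * c3 t) volume 0 T :=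
    ContinuousOn.intervalIntegrable_of_Icc hT.le (by fun_prop)
  have i3 : IntervalIntegrable (fun t => θ t * a3 t) volume 0 T :=
    ContinuousOn.intervalIntegrable_of_Icc hT.le (by fun_prop)
  -- In this combination `a3` cancels and, by `h3`, so does `c3`; only terms with a derivative of a
  -- cutoff remain.
  have hfin := intervalIntegral.integral_sub (i1.sub i2) i3
  rw [intervalIntegral.integral_sub i1 i2, h1, h2] at hfin
  refine Eq.trans ?_ (hfin.trans (by ring))
  refine intervalIntegral.integral_congr fun t ht => ?_
  rw [h4 t (hIcc ht), ha1, hc1, ha2, hb1]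
  linear_combination θ t * h3 t (hIcc ht)

end IsSolution
-- Conservation of the Wronskian
lemma abs_integral_mul_le_boundaryStrip {L ε K : ℝ} (hL : 0 < L) {u w : ℝ → ℝ}
    (hu : IntervalIntegrable u volume 0 L) (hK : ∀ y ∈ boundaryStrip L ε, |w y| ≤ K)
    (h0 : ∀ y ∈ Ioo 0 L, y ∉ boundaryStrip L ε → w y = 0) :
    |∫ y in (0 : ℝ)..L, u y * w y| ≤ K * ∫ y in boundaryStrip L ε, |u y| := by
  have hsub : boundaryStrip L ε ⊆ Ioo 0 L := inter_subset_left
  rw [intervalIntegral.integral_of_le hL.le, integral_Ioc_eq_integral_Ioo,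
    setIntegral_eq_of_subset_of_forall_sdiff_eq_zero measurableSet_Ioo hsub
      (fun y hy => by rw [h0 y hy.1 hy.2, mul_zero]), ← integral_const_mul,
    ← Real.norm_eq_abs]
  rw [intervalIntegrable_iff_integrableOn_Ioo_of_le hL.le] at hu
  refine norm_integral_le_of_norm_le ((hu.mono_set hsub).abs.const_mul K)
    ((ae_restrict_iff' (measurableSet_boundaryStrip L ε)).2 (ae_of_all _ fun y hy => ?_))
  rw [norm_mul, Real.norm_eq_abs, Real.norm_eq_abs, mul_comm]
  exact mul_le_mul_of_nonneg_right (hK y hy) (abs_nonneg _)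

lemma eq_zero_of_abs_le_mul_sqrt {X C : ℝ} (h : ∀ ε > 0, |X| ≤ C * √ε) : X = 0 := by
  have hlim : Tendsto (fun ε : ℝ => C * √ε) (𝓝[>] 0) (𝓝 0) := by
    have : Continuous fun ε : ℝ => C * √ε := by fun_prop
    simpa using (this.tendsto 0).mono_left nhdsWithin_le_nhds
  have := ge_of_tendsto hlim (eventually_mem_nhdsWithin.mono fun ε hε => h ε hε)
  exact abs_nonpos_iff.1 this

/-- The Wronskian of a solution and of a travelling wave solution of the same boundary value
problem; `u` and `ut` are the shape and the velocity at time `t`. -/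
noncomputable def wronskian (v L : ℝ) (e e1 : ℝ → ℝ) (u ut : ℝ → ℝ) (t : ℝ) : ℝ :=
  (∫ y in (0 : ℝ)..L, ut (y + v * t) * waveDiff v e y t)
    - ∫ y in (0 : ℝ)..L, u (y + v * t) * waveDiffT v e1 y t

/-- The velocity of the wave is the space derivative of `e (t + x) + e (γ (t - x))`, so integration
by parts moves the derivative onto `u`. No boundary term appears, by `IsH10.integral_deriv_mul`. -/
lemma wronskian_eq_integral {v L t K P : ℝ} (hL : 0 < L) {e e1 e2 u ux ut : ℝ → ℝ}
    (he : IsProfile P K e e1 e2) (hu : IsH10 (v * t) (L + v * t) u ux)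
    (hut : IntervalIntegrable ut volume (v * t) (L + v * t)) :
    wronskian v L e e1 u ut t = ∫ x in (v * t)..(L + v * t),
      ((ux x + ut x) * e (t + x) + (ux x - ut x) * e (gam v * (t - x))) := by
  have hlt : v * t < L + v * t := by linarith
  have hd : ∀ x, HasDerivAt (fun x => e (t + x) + e (gam v * (t - x)))
      (e1 (t + x) - gam v * e1 (gam v * (t - x))) x := by
    intro x
    have h1 : HasDerivAt (fun z => t + z) 1 x := (hasDerivAt_id x).const_add t
    have h2 : HasDerivAt (fun z => gam v * (t - z)) (-gam v) x := by
      simpa using ((hasDerivAt_id x).const_sub t).const_mul (gam v)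
    refine (((he.hasDerivAt _).comp x h1).add ((he.hasDerivAt _).comp x h2)).congr_deriv ?_
    ring
  have hc := he.contDiff.continuous
  have hc1 := he.contDiff_deriv.continuous
  have h := hu.integral_deriv_mul hlt hd (by fun_prop)
  have hi := hu.intervalIntegrable_deriv hlt
  have e1' : ∫ y in (0 : ℝ)..L, ut (y + v * t) * waveDiff v e y t
      = ∫ x in (v * t)..(L + v * t), ut x * (e (t + x) - e (gam v * (t - x))) := by
    rw [integral_translate]; rfl
  have e2' : ∫ y in (0 : ℝ)..L, u (y + v * t) * waveDiffT v e1 y t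
      = ∫ x in (v * t)..(L + v * t), u x * (e1 (t + x) - gam v * e1 (gam v * (t - x))) := by
    rw [integral_translate]; rfl
  rw [wronskian, e1', e2', sub_eq_add_neg, ← h, ← intervalIntegral.integral_add]
  · congr 1; ext x; ring
  · exact hut.mul_continuousOn (by fun_prop)
  · exact hi.mul_continuousOn (by fun_prop)

namespace IsSolution

variable {v L T : ℝ} {φ0 φ1 : ℝ → ℝ} {φ φx φt : ℝ → ℝ → ℝ}

/-- The error terms caused by the cutoff tend to zero. -/
lemma exists_cutoff_error_le (hφ : IsSolution v L T φ0 φ1 φ φx φt) (hv0 : 0 < v) (hv1 : v < 1)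
    (hL : 0 < L) {K : ℝ} {e e1 e2 : ℝ → ℝ} (he : IsProfile (L2 v L) K e e1 e2) :
    ∃ C, 0 ≤ C ∧ ∀ ε > 0, ∃ χ : ℝ → ℝ, ContDiff ℝ ∞ χ ∧ HasCompactSupport χ ∧
      tsupport χ ⊆ Ioo 0 L ∧ ∀ t ∈ Icc 0 T,
      |wronskian v L e e1 (fun x => φ x t) (fun x => φt x t) t
        - ((∫ y in (0 : ℝ)..L, φt (y + v * t) t * (χ y * waveDiff v e y t))
          - ∫ y in (0 : ℝ)..L, φ (y + v * t) t * (χ y * waveDiffT v e1 y t))| ≤ C * √ε ∧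
      |(∫ y in (0 : ℝ)..L, φ (y + v * t) t *
              (deriv χ y * (v * waveDiffT v e1 y t + waveDiffX v e1 y t)))
          - v * (∫ y in (0 : ℝ)..L, φt (y + v * t) t * (deriv χ y * waveDiff v e y t))
          - ∫ y in (0 : ℝ)..L, φx (y + v * t) t * (deriv χ y * waveDiff v e y t)| ≤ C * √ε := by
  have hU := hφ.isL2Curve
  have hUt := hφ.isL2Curve_t
  have hUx := hφ.isL2Curve_x
  obtain ⟨M, hM0, hM⟩ := hU.exists_integral_boundaryStrip_le hL
  obtain ⟨Mt, hMt0, hMt⟩ := hUt.exists_integral_boundaryStrip_le hL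
  obtain ⟨Mx, hMx0, hMx⟩ := hUx.exists_integral_boundaryStrip_le hL
  obtain ⟨C, hC0, hC⟩ := exists_cutoff L
  have hg := gam_pos hv0 hv1
  have hK0 := he.bound_nonneg
  set D := K * (1 + gam v) with hD
  have hD0 : 0 ≤ D := by positivity
  have hWc : ∀ t, Continuous fun y => waveDiff v e y t := fun t =>
    (continuous_waveDiff v he.contDiff.continuous).comp (by fun_prop : Continuous fun y => (y, t))
  have hWtc : ∀ t, Continuous fun y => waveDiffT v e1 y t := fun t =>
    (continuous_waveDiffT v he.contDiff_deriv.continuous).comp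
      (by fun_prop : Continuous fun y => (y, t))
  -- The wave is `O(ε)` on the strip, which compensates the factor `C / ε` from the cutoff.
  have hW : ∀ {y ε : ℝ}, y ∈ boundaryStrip L ε → ∀ t, |waveDiff v e y t| ≤ D * (2 * ε) := by
    rintro y ε ⟨⟨h0, h1⟩, h | h⟩ t
    · exact (he.abs_waveDiff_le_left hv0 hv1 h0.le t).trans
        (mul_le_mul_of_nonneg_left (le_of_lt h) hD0)
    · refine (he.abs_waveDiff_le_right hv0 hv1 h1.le t).trans (mul_le_mul_of_nonneg_left ?_ hD0)
      have : L - 2 * ε < y := h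
      linarith
  have hWL : ∀ {y : ℝ}, y ∈ Ioo 0 L → ∀ t, |waveDiff v e y t| ≤ D * L := fun hy t =>
    (he.abs_waveDiff_le_left hv0 hv1 hy.1.le t).trans (mul_le_mul_of_nonneg_left hy.2.le hD0)
  refine ⟨D * L * Mt + D * M + (8 * C * D * Mx + 2 * C * D * Mt + 2 * C * D * Mx), by positivity,
    fun ε hε => ?_⟩
  obtain ⟨χ, hχ, hχc, hχt, hχ01, hχd, hχ1⟩ := hC ε hε
  have hχcont := hχ.continuous
  refine ⟨χ, hχ, hχc, hχt, fun t ht => ?_⟩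
  have iU := hU.intervalIntegrable hL ht
  have iUt := hUt.intervalIntegrable hL ht
  have iUx := hUx.intervalIntegrable hL ht
  have h1χ : ∀ y, |1 - χ y| ≤ 1 := fun y => abs_le.2 ⟨by linarith [(hχ01 y).2], by linarith [(hχ01 y).1]⟩
  constructor
  · have hsplit : ∀ {u w : ℝ → ℝ}, IntervalIntegrable u volume 0 L → Continuous w →
        (∫ y in (0 : ℝ)..L, u y * w y) - ∫ y in (0 : ℝ)..L, u y * (χ y * w y)
          = ∫ y in (0 : ℝ)..L, u y * ((1 - χ y) * w y) := by
      intro u w hu hw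
      have h1 : IntervalIntegrable (fun y => u y * (χ y * w y)) volume 0 L :=
        hu.mul_continuousOn (hχcont.mul hw).continuousOn
      rw [← intervalIntegral.integral_sub (hu.mul_continuousOn hw.continuousOn) h1]
      congr 1; ext y; ring
    have s1 := hsplit iUt (hWc t)
    have s2 := hsplit iU (hWtc t)
    have b1 := abs_integral_mul_le_boundaryStrip (ε := ε) (K := 1 * (D * L)) hL iUt
      (w := fun y => (1 - χ y) * waveDiff v e y t) (fun y hy => by
        rw [abs_mul]
        exact mul_le_mul (h1χ y) (hWL hy.1 t) (abs_nonneg _) zero_le_one)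
      (fun y hy hy' => by rw [(hχ1 y hy hy').1, sub_self, zero_mul])
    have b2 := abs_integral_mul_le_boundaryStrip (ε := ε) (K := 1 * D) hL iU
      (w := fun y => (1 - χ y) * waveDiffT v e1 y t) (fun y hy => by
        rw [abs_mul]
        exact mul_le_mul (h1χ y) (he.abs_waveDiffT_le hv0 hv1 y t) (abs_nonneg _) zero_le_one)
      (fun y hy hy' => by rw [(hχ1 y hy hy').1, sub_self, zero_mul])
    rw [← s1] at b1
    rw [← s2] at b2
    have c1 := b1.trans (mul_le_mul_of_nonneg_left (hMt t ht ε hε) (by positivity))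
    have c2 := b2.trans (mul_le_mul_of_nonneg_left (hM t ht ε hε) (by positivity))
    rw [wronskian, sub_sub_sub_comm]
    refine (abs_sub _ _).trans ((add_le_add c1 c2).trans ?_)
    have : 0 ≤ (8 * C * D * Mx + 2 * C * D * Mt + 2 * C * D * Mx) * √ε := by positivity
    linarith
  · have hCε : C / ε * (D * (2 * ε)) = 2 * C * D := by field_simp
    have hb : ∀ {u : ℝ → ℝ}, IntervalIntegrable u volume 0 L →
        |∫ y in (0 : ℝ)..L, u y * (deriv χ y * waveDiff v e y t)|
          ≤ 2 * C * D * ∫ y in boundaryStrip L ε, |u y| := by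
      intro u hu
      rw [← hCε]
      refine abs_integral_mul_le_boundaryStrip hL hu (fun y hy => ?_) (fun y hy hy' => ?_)
      · rw [abs_mul]
        exact mul_le_mul (hχd y) (hW hy t) (abs_nonneg _) (by positivity)
      · rw [(hχ1 y hy hy').2, zero_mul]
    have b1 := (hb iUt).trans (mul_le_mul_of_nonneg_left (hMt t ht ε hε) (by positivity))
    have b2 := (hb iUx).trans (mul_le_mul_of_nonneg_left (hMx t ht ε hε) (by positivity))
    -- The derivatives of the wave need not be small at the boundary, so here smallness must come
    -- from `φ`: it is `O(√ε)` pointwise on a strip of measure at most `4 * ε` (`b4`), which absorbs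
    -- `C / ε`.
    have b3 := abs_integral_mul_le_boundaryStrip (ε := ε) (K := C / ε * (2 * D)) hL iU
      (w := fun y => deriv χ y * (v * waveDiffT v e1 y t + waveDiffX v e1 y t)) (fun y hy => by
        rw [abs_mul]
        refine mul_le_mul (hχd y) ?_ (abs_nonneg _) (by positivity)
        refine (abs_add_le _ _).trans ?_
        rw [abs_mul, abs_of_pos hv0]
        nlinarith [he.abs_waveDiffT_le hv0 hv1 y t, he.abs_waveDiffX_le hv0 hv1 y t,
          abs_nonneg (waveDiffT v e1 y t)])
      (fun y hy hy' => by rw [(hχ1 y hy hy').2, zero_mul])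
    have b4 : ∫ y in boundaryStrip L ε, |φ (y + v * t) t| ≤ Mx * √ε * (4 * ε) := by
      have hfin : volume (boundaryStrip L ε) < ⊤ :=
        (measure_mono inter_subset_left).trans_lt measure_Ioo_lt_top
      have h := setIntegral_mono_on (hU.integrableOn_abs_boundaryStrip ht ε)
        (integrableOn_const hfin.ne) (measurableSet_boundaryStrip L ε)
        (fun y hy => (hφ.abs_le_integral_boundaryStrip hL ht hy).trans (hMx t ht ε hε))
      refine h.trans ?_
      rw [setIntegral_const, smul_eq_mul, mul_comm]
      exact mul_le_mul_of_nonneg_left (measureReal_boundaryStrip_le hε) (by positivity)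
    have b5 := b3.trans (mul_le_mul_of_nonneg_left b4 (by positivity))
    have b6 : C / ε * (2 * D) * (Mx * √ε * (4 * ε)) = 8 * C * D * Mx * √ε := by
      field_simp
      ring
    rw [b6] at b5
    refine (abs_sub _ _).trans ((add_le_add ((abs_sub _ _).trans (add_le_add b5 le_rfl)) b2).trans ?_)
    rw [abs_mul, abs_of_pos hv0]
    have h1 : v * |∫ y in (0 : ℝ)..L, φt (y + v * t) t * (deriv χ y * waveDiff v e y t)|
        ≤ 2 * C * D * (Mt * √ε) := by
      refine le_trans ?_ b1
      exact mul_le_of_le_one_left (abs_nonneg _) hv1.le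
    have : 0 ≤ (D * L * Mt + D * M) * √ε := by positivity
    linarith

/-- The Wronskian is conserved. -/
theorem wronskian_eq (hφ : IsSolution v L T φ0 φ1 φ φx φt) (hv0 : 0 < v) (hv1 : v < 1)
    (hL : 0 < L) (hT : 0 < T) {K : ℝ} {e e1 e2 : ℝ → ℝ} (he : IsProfile (L2 v L) K e e1 e2) :
    ∀ t ∈ Icc 0 T, wronskian v L e e1 (fun x => φ x t) (fun x => φt x t) t
      = wronskian v L e e1 (fun x => φ x 0) (fun x => φt x 0) 0 := by
  have hW := continuous_waveDiff v he.contDiff.continuous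
  have hWt := continuous_waveDiffT v he.contDiff_deriv.continuous
  have hWx := continuous_waveDiffX v he.contDiff_deriv.continuous
  have hU := hφ.isL2Curve
  have hUt := hφ.isL2Curve_t
  have hUx := hφ.isL2Curve_x
  have hAc : ContinuousOn
      (fun t => wronskian v L e e1 (fun x => φ x t) (fun x => φt x t) t) (Icc 0 T) :=
    (hUt.continuousOn_integral_mul hL hW).sub (hU.continuousOn_integral_mul hL hWt)
  refine eq_of_integral_deriv_mul_eq_zero hT hAc fun θ hθ hθc hθt => ?_
  obtain ⟨C, hC0, hC⟩ := hφ.exists_cutoff_error_le hv0 hv1 hL he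
  have hθ1 : Continuous (deriv θ) := hθ.continuous_deriv (by simp)
  obtain ⟨N, hN⟩ := isCompact_Icc.exists_bound_of_continuousOn (s := Icc 0 T)
    (hθ.continuous.prodMk hθ1).continuousOn
  have hN0 : 0 ≤ N := (norm_nonneg _).trans (hN 0 (left_mem_Icc.2 hT.le))
  -- The two error terms contribute `N * C * √ε` each to the integrand, over a time interval of
  -- length `T`. The integral itself does not depend on `ε`.
  refine eq_zero_of_abs_le_mul_sqrt (C := 2 * N * C * T) fun ε hε => ?_
  obtain ⟨χ, hχ, hχc, hχt, hest⟩ := hC ε hε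
  have hzero := hφ.integral_cutoff_eq_zero hL hT he hθ hθc hθt hχ hχc hχt
  have hχm : ∀ {u w : ℝ → ℝ → ℝ} {g : ℝ → ℝ}, IsL2Curve L T u → Continuous g →
      (Continuous fun p : ℝ × ℝ => w p.1 p.2) →
      ContinuousOn (fun t => ∫ y in (0 : ℝ)..L, u y t * (g y * w y t)) (Icc 0 T) :=
    fun {u w g} hu hg hw => hu.continuousOn_integral_mul hL
      (w := fun y t => g y * w y t) ((hg.comp continuous_fst).mul hw)
  have hχ0 := hχ.continuous
  have hχ1 : Continuous (deriv χ) := hχ.continuous_deriv (by simp)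
  have cA := (hχm hUt hχ0 hW).sub (hχm hU hχ0 hWt)
  have cB := ((hχm (w := fun y t => v * waveDiffT v e1 y t + waveDiffX v e1 y t) hU hχ1
    ((continuous_const.mul hWt).add hWx)).sub
    (continuousOn_const (c := v).mul (hχm hUt hχ1 hW))).sub (hχm hUx hχ1 hW)
  have i1 : IntervalIntegrable
      (fun t => wronskian v L e e1 (fun x => φ x t) (fun x => φt x t) t * deriv θ t)
      volume 0 T := (hAc.mul hθ1.continuousOn).intervalIntegrable_of_Icc hT.le
  have i2 := ((hθ1.continuousOn.mul cA).add
    (hθ.continuous.continuousOn.mul cB)).intervalIntegrable_of_Icc (μ := volume) hT.le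
  have hsub := intervalIntegral.integral_sub i1 i2
  simp only [Pi.sub_apply, Pi.mul_apply, Pi.add_apply] at hsub
  rw [hzero, sub_zero] at hsub
  rw [← hsub, ← Real.norm_eq_abs]
  refine (intervalIntegral.norm_integral_le_of_norm_le_const (C := 2 * N * C * √ε) ?_).trans
    (le_of_eq ?_)
  · intro t ht
    rw [uIoc_of_le hT.le] at ht
    have ht' := Ioc_subset_Icc_self ht
    obtain ⟨h1, h2⟩ := hest t ht'
    have h3 := hN t ht'
    rw [Prod.norm_def, max_le_iff] at h3
    have h4 : ∀ a b c d f : ℝ, |a| ≤ N → |b| ≤ N → |c - d| ≤ C * √ε → |f| ≤ C * √ε →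
        |c * b - (b * d + a * f)| ≤ 2 * N * C * √ε := by
      intro a b c d f ha hb hcd hf
      have : c * b - (b * d + a * f) = b * (c - d) - a * f := by ring
      rw [this]
      refine (abs_sub _ _).trans ?_
      rw [abs_mul, abs_mul]
      have e1 := mul_le_mul hb hcd (abs_nonneg _) hN0
      have e2 := mul_le_mul ha hf (abs_nonneg _) hN0
      linarith
    exact h4 _ _ _ _ _ h3.1 h3.2 h1 h2
  · rw [sub_zero, abs_of_pos hT]
    ring

end IsSolution
-- Reflections and the extended functions
lemma memLp_comp_sub_mul {m k a b : ℝ} (hk : 0 < k) {g : ℝ → ℝ}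
    (hg : MemLp g 2 (volume.restrict (Ioo (m - k * b) (m - k * a)))) :
    MemLp (fun y => g (m - k * y)) 2 (volume.restrict (Ioo a b)) := by
  let e : ℝ ≃ₜ ℝ := (Homeomorph.mulLeft₀ k hk.ne').trans (Homeomorph.subLeft m)
  have he : ∀ y, e y = m - k * y := fun y => rfl
  have hemb : MeasurableEmbedding e := e.measurableEmbedding
  have hmap : Measure.map e volume = ENNReal.ofReal |k⁻¹| • volume := by
    have : (e : ℝ → ℝ) = (fun z => m - z) ∘ (fun y => k * y) := rfl
    rw [this, ← Measure.map_map (by fun_prop) (by fun_prop), Real.map_volume_mul_left hk.ne',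
      Measure.map_smul, (Measure.measurePreserving_sub_left volume m).map_eq]
  have hpre : e ⁻¹' Ioo (m - k * b) (m - k * a) = Ioo a b := by
    ext y
    simp only [mem_preimage, he, mem_Ioo]
    constructor
    · rintro ⟨h1, h2⟩
      exact ⟨lt_of_mul_lt_mul_left (by linarith) hk.le, lt_of_mul_lt_mul_left (by linarith) hk.le⟩
    · rintro ⟨h1, h2⟩
      have := mul_lt_mul_of_pos_left h1 hk
      have := mul_lt_mul_of_pos_left h2 hk
      exact ⟨by linarith, by linarith⟩
  have h := hg.smul_measure (c := ENNReal.ofReal |k⁻¹|) ENNReal.ofReal_ne_top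
  rw [← Measure.restrict_smul, ← hmap, hemb.restrict_map, hpre, hemb.memLp_map_measure_iff] at h
  exact h

lemma memLp_Ioo_of_adjacent {a b c : ℝ} {f : ℝ → ℝ}
    (h1 : MemLp f 2 (volume.restrict (Ioo a b))) (h2 : MemLp f 2 (volume.restrict (Ioo b c))) :
    MemLp f 2 (volume.restrict (Ioo a c)) := by
  rw [restrict_Ioo_eq_restrict_Ioc] at h1 ⊢
  have h := MemLp.piecewise (μ := volume.restrict (Ioc a c)) (s := Iic b) (f := f) (g := f) (p := 2)
    measurableSet_Iic
    (h1.mono_measure (by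
      rw [Measure.restrict_restrict measurableSet_Iic]
      exact Measure.restrict_mono_set _ fun x hx => ⟨hx.2.1, hx.1⟩))
    (by
      rw [restrict_Ioo_eq_restrict_Ioc] at h2
      refine h2.mono_measure ?_
      rw [Measure.restrict_restrict measurableSet_Iic.compl]
      exact Measure.restrict_mono_set _ fun x hx => ⟨not_le.1 hx.1, hx.2.2⟩)
  rwa [piecewise_same] at h

lemma intervalIntegrable_sq_of_memLp {a b : ℝ} (hab : a ≤ b) {f : ℝ → ℝ}
    (hf : MemLp f 2 (volume.restrict (Ioo a b))) : IntervalIntegrable (fun x => f x ^ 2) volume a b := by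
  rw [intervalIntegrable_iff_integrableOn_Ioo_of_le hab]
  exact hf.integrable_sq

lemma intervalIntegrable_of_memLp {a b : ℝ} (hab : a ≤ b) {f : ℝ → ℝ}
    (hf : MemLp f 2 (volume.restrict (Ioo a b))) : IntervalIntegrable f volume a b := by
  rw [intervalIntegrable_iff_integrableOn_Ioo_of_le hab]
  exact hf.integrable (by norm_num)

lemma intervalIntegrable_ofReal_mul {a b : ℝ} (hab : a ≤ b) {f : ℝ → ℝ} {w : ℝ → ℂ}
    (hf : MemLp f 2 (volume.restrict (Ioo a b))) (hw : Continuous w) :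
    IntervalIntegrable (fun x => (f x : ℂ) * w x) volume a b := by
  have h : IntervalIntegrable (fun x => (f x : ℂ)) volume a b := by
    have := intervalIntegrable_of_memLp hab hf
    rw [intervalIntegrable_iff] at this ⊢
    exact this.ofReal
  exact h.mul_continuousOn hw.continuousOn

/-- A function `f` which is related to `q` by a change of variables `x = m - k * y`. -/
structure IsReflection (m k a b : ℝ) (q f : ℝ → ℝ) : Prop where
  pos : 0 < k
  le : a ≤ b
  memLp : MemLp q 2 (volume.restrict (Ioo a b))
  apply_eq : ∀ y ∈ Ioo a b, f (m - k * y) = 1 / k * q y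

namespace IsReflection

variable {m k a b : ℝ} {q f : ℝ → ℝ}

lemma memLp_right (h : IsReflection m k a b q f) :
    MemLp f 2 (volume.restrict (Ioo (m - k * b) (m - k * a))) := by
  have hk := h.pos
  have hq : MemLp (fun x => q (m / k - 1 / k * x)) 2
      (volume.restrict (Ioo (m - k * b) (m - k * a))) := by
    refine memLp_comp_sub_mul (by positivity) ?_
    have e1 : m / k - 1 / k * (m - k * a) = a := by field_simp; ring
    have e2 : m / k - 1 / k * (m - k * b) = b := by field_simp; ring
    rw [e1, e2]
    exact h.memLp
  refine (memLp_congr_ae ?_).1 (hq.const_mul (1 / k))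
  refine (ae_restrict_iff' measurableSet_Ioo).2 (ae_of_all _ fun x hx => ?_)
  have e3 : m - k * (m / k - 1 / k * x) = x := by field_simp; ring
  have := h.apply_eq (m / k - 1 / k * x) ⟨by
      refine lt_of_mul_lt_mul_left ?_ hk.le
      linarith [hx.2], by
      refine lt_of_mul_lt_mul_left ?_ hk.le
      linarith [hx.1]⟩
  rw [e3] at this
  exact this.symm

/-- The square contributes `1 / k ^ 2` and the Jacobian `k`. In `integral_mul` the factor `1 / k`
and the Jacobian cancel exactly. -/
lemma integral_sq (h : IsReflection m k a b q f) :
    ∫ x in (m - k * b)..(m - k * a), f x ^ 2 = 1 / k * ∫ y in a..b, q y ^ 2 := by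
  have hk := h.pos
  rw [← intervalIntegral.smul_integral_comp_sub_mul, smul_eq_mul,
    intervalIntegral.integral_congr_Ioo_of_le (g := fun y => (1 / k) ^ 2 * q y ^ 2) h.le
      (fun y hy => by simp only [h.apply_eq y hy, mul_pow]), intervalIntegral.integral_const_mul]
  field_simp

lemma integral_mul (h : IsReflection m k a b q f) (w : ℝ → ℂ) :
    ∫ x in (m - k * b)..(m - k * a), (f x : ℂ) * w x
      = ∫ y in a..b, (q y : ℂ) * w (m - k * y) := by
  have hk : (k : ℂ) ≠ 0 := by exact_mod_cast h.pos.ne'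
  rw [← intervalIntegral.smul_integral_comp_sub_mul, Complex.real_smul,
    intervalIntegral.integral_congr_Ioo_of_le
      (g := fun y => (1 / k : ℂ) * ((q y : ℂ) * w (m - k * y))) h.le
      (fun y hy => by simp only [h.apply_eq y hy]; push_cast; ring),
    intervalIntegral.integral_const_mul]
  field_simp

end IsReflection

section extension

variable {v L t : ℝ} {g h : ℝ → ℝ}

lemma extX_of_mem {x : ℝ} (hx : x ∈ Ioo (v * t) (L + v * t)) (g : ℝ → ℝ) :
    extX v L t g x = g x := by
  rw [extX, if_neg (not_lt.2 hx.1.le), if_pos hx.2]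

lemma extT_of_mem {x : ℝ} (hx : x ∈ Ioo (v * t) (L + v * t)) (g : ℝ → ℝ) :
    extT v L t g x = g x := by
  rw [extT, if_neg (not_lt.2 hx.1.le), if_pos hx.2]

/-- The reflection with ratio `γ` fixes `L + v t` and maps `v t` to `L₂ + v t`. The two extensions
carry opposite signs, so their sum reflects to the difference of the data. The free endpoint `a`
serves the pointwise expansion. -/
lemma isReflection_right (hv0 : 0 < v) (hv1 : v < 1) (hL : 0 < L) {a : ℝ}
    (ha : a ∈ Ico (v * t) (L + v * t))
    (hg : MemLp g 2 (volume.restrict (Ioo (v * t) (L + v * t))))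
    (hh : MemLp h 2 (volume.restrict (Ioo (v * t) (L + v * t)))) :
    IsReflection (L2 v L + v * t + gam v * (v * t)) (gam v) a (L + v * t) (fun y => g y - h y)
      (fun x => extX v L t g x + extT v L t h x) := by
  have hγ := gam_pos hv0 hv1
  refine ⟨hγ, ha.2.le, (hg.sub hh).mono_measure
    (Measure.restrict_mono_set _ (Ioo_subset_Ioo_left ha.1)), fun y hy => ?_⟩
  have h1 := mul_lt_mul_of_pos_left hy.2 hγ
  have hL2 := L2_eq hv1 L
  have h2 : L + v * t < L2 v L + v * t + gam v * (v * t) - gam v * y := by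
    rw [hL2]; linarith
  have h3 : 1 / gam v * (v * t - (L2 v L + v * t + gam v * (v * t) - gam v * y))
      + 2 * L / (1 + v) + v * t = y := by
    have : 1 - v ≠ 0 := by linarith
    have : 1 + v ≠ 0 := by linarith
    rw [L2, gam]
    field_simp
    ring
  simp only [extX, extT]
  rw [if_neg (by linarith), if_neg (by linarith), if_neg (by linarith), if_neg (by linarith), h3]
  ring

/-- Here the ratio is `1 / γ`, with `v t` fixed and `L + v t` mapped to `-L₁ + v t`; the difference
of the extensions reflects to the sum of the data. -/
lemma isReflection_left (hv0 : 0 < v) (hv1 : v < 1) (hL : 0 < L)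
    (hg : MemLp g 2 (volume.restrict (Ioo (v * t) (L + v * t))))
    (hh : MemLp h 2 (volume.restrict (Ioo (v * t) (L + v * t)))) :
    IsReflection (v * t + 1 / gam v * (v * t)) (1 / gam v) (v * t) (L + v * t)
      (fun y => g y + h y) (fun x => extX v L t g x - extT v L t h x) := by
  have hγ := gam_pos hv0 hv1
  refine ⟨by positivity, by linarith, hg.add hh, fun y hy => ?_⟩
  have h1 := mul_lt_mul_of_pos_left hy.1 (by positivity : 0 < 1 / gam v)
  have h3 : gam v * (v * t - (v * t + 1 / gam v * (v * t) - 1 / gam v * y)) + v * t = y := by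
    field_simp
    ring
  simp only [extX, extT]
  rw [if_pos (by linarith), if_pos (by linarith), h3]
  field_simp
  ring

lemma right_endpoint (hv1 : v < 1) :
    L2 v L + v * t + gam v * (v * t) - gam v * (L + v * t) = L + v * t := by
  rw [L2_eq hv1]; ring

lemma left_endpoint (hv0 : 0 < v) :
    v * t + 1 / gam v * (v * t) - 1 / gam v * (L + v * t) = -L1 v L + v * t := by
  have : 1 + v ≠ 0 := by linarith
  rw [gam, L1]
  field_simp
  ring

lemma memLp_add_middle (hg : MemLp g 2 (volume.restrict (Ioo (v * t) (L + v * t))))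
    (hh : MemLp h 2 (volume.restrict (Ioo (v * t) (L + v * t)))) :
    MemLp (fun x => extX v L t g x + extT v L t h x) 2
      (volume.restrict (Ioo (v * t) (L + v * t))) := by
  refine (memLp_congr_ae ?_).1 (hg.add hh)
  exact (ae_restrict_iff' measurableSet_Ioo).2
    (ae_of_all _ fun x hx => by simp [extX_of_mem hx, extT_of_mem hx])

lemma memLp_sub_middle (hg : MemLp g 2 (volume.restrict (Ioo (v * t) (L + v * t))))
    (hh : MemLp h 2 (volume.restrict (Ioo (v * t) (L + v * t)))) :
    MemLp (fun x => extX v L t g x - extT v L t h x) 2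
      (volume.restrict (Ioo (v * t) (L + v * t))) := by
  refine (memLp_congr_ae ?_).1 (hg.sub hh)
  exact (ae_restrict_iff' measurableSet_Ioo).2
    (ae_of_all _ fun x hx => by simp [extX_of_mem hx, extT_of_mem hx])

lemma memLp_ext_add (hv0 : 0 < v) (hv1 : v < 1) (hL : 0 < L)
    (hg : MemLp g 2 (volume.restrict (Ioo (v * t) (L + v * t))))
    (hh : MemLp h 2 (volume.restrict (Ioo (v * t) (L + v * t)))) :
    MemLp (fun x => extX v L t g x + extT v L t h x) 2
      (volume.restrict (Ioo (v * t) (L2 v L + v * t))) := by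
  have h2 := (isReflection_right hv0 hv1 hL ⟨le_rfl, by linarith⟩ hg hh).memLp_right
  rw [right_endpoint hv1, add_sub_cancel_right] at h2
  exact memLp_Ioo_of_adjacent (memLp_add_middle hg hh) h2

/-- The integral of the right extension, started at a point `a` of the interval. -/
lemma integral_ext_add_mul (hv0 : 0 < v) (hv1 : v < 1) (hL : 0 < L) {a : ℝ}
    (ha : a ∈ Ico (v * t) (L + v * t))
    (hg : MemLp g 2 (volume.restrict (Ioo (v * t) (L + v * t))))
    (hh : MemLp h 2 (volume.restrict (Ioo (v * t) (L + v * t)))) {w : ℝ → ℂ} (hw : Continuous w) :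
    ∫ x in a..(L2 v L + v * t + gam v * (v * t) - gam v * a),
        ((extX v L t g x + extT v L t h x : ℝ) : ℂ) * w x
      = ∫ y in a..(L + v * t), (((g y + h y : ℝ) : ℂ) * w y
        + ((g y - h y : ℝ) : ℂ) * w (L2 v L + v * t + gam v * (v * t) - gam v * y)) := by
  have hr := isReflection_right hv0 hv1 hL ha hg hh
  have hsub : ∀ {f : ℝ → ℝ}, MemLp f 2 (volume.restrict (Ioo (v * t) (L + v * t))) →
      MemLp f 2 (volume.restrict (Ioo a (L + v * t))) := fun hf =>
    hf.mono_measure (Measure.restrict_mono_set _ (Ioo_subset_Ioo_left ha.1))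
  have hle : L + v * t ≤ L2 v L + v * t + gam v * (v * t) - gam v * a := by
    rw [← right_endpoint (L := L) (t := t) hv1]
    have := mul_le_mul_of_nonneg_left ha.2.le (gam_pos hv0 hv1).le
    linarith
  have h2 := hr.memLp_right
  rw [right_endpoint hv1] at h2
  have hi := hr.integral_mul w
  rw [right_endpoint hv1] at hi
  rw [← intervalIntegral.integral_add_adjacent_intervals
    (intervalIntegrable_ofReal_mul ha.2.le (hsub (memLp_add_middle hg hh)) hw)
    (intervalIntegrable_ofReal_mul hle h2 hw), hi, intervalIntegral.integral_add
    (intervalIntegrable_ofReal_mul (f := fun y => g y + h y) ha.2.le (hsub (hg.add hh)) hw)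
    (intervalIntegrable_ofReal_mul (f := fun y => g y - h y)
      (w := fun y => w (L2 v L + v * t + gam v * (v * t) - gam v * y)) ha.2.le
      (hsub (hg.sub hh)) (by fun_prop))]
  congr 1
  refine intervalIntegral.integral_congr_Ioo_of_le ha.2.le fun x hx => ?_
  have hx' : x ∈ Ioo (v * t) (L + v * t) := ⟨ha.1.trans_lt hx.1, hx.2⟩
  simp only [extX_of_mem hx', extT_of_mem hx']

lemma neg_L1_le (hv0 : 0 < v) (hv1 : v < 1) (hL : 0 < L) : -L1 v L + v * t ≤ v * t := by
  have : 0 ≤ L1 v L := mul_nonneg (div_nonneg (by linarith) (by linarith)) hL.le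
  linarith

lemma integral_ext_sub_mul (hv0 : 0 < v) (hv1 : v < 1) (hL : 0 < L)
    (hg : MemLp g 2 (volume.restrict (Ioo (v * t) (L + v * t))))
    (hh : MemLp h 2 (volume.restrict (Ioo (v * t) (L + v * t)))) {w : ℝ → ℂ} (hw : Continuous w) :
    ∫ x in (-L1 v L + v * t)..(L + v * t), ((extX v L t g x - extT v L t h x : ℝ) : ℂ) * w x
      = ∫ y in (v * t)..(L + v * t), (((g y + h y : ℝ) : ℂ)
          * w (v * t + 1 / gam v * (v * t) - 1 / gam v * y) + ((g y - h y : ℝ) : ℂ) * w y) := by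
  have hr := isReflection_left hv0 hv1 hL hg hh
  have hle : v * t ≤ L + v * t := by linarith
  have h2 := hr.memLp_right
  rw [left_endpoint hv0, add_sub_cancel_right] at h2
  have hi := hr.integral_mul w
  rw [left_endpoint hv0, add_sub_cancel_right] at hi
  rw [← intervalIntegral.integral_add_adjacent_intervals
    (intervalIntegrable_ofReal_mul (neg_L1_le hv0 hv1 hL) h2 hw)
    (intervalIntegrable_ofReal_mul hle (memLp_sub_middle hg hh) hw), hi,
    intervalIntegral.integral_add
    (intervalIntegrable_ofReal_mul (f := fun y => g y + h y)
      (w := fun y => w (v * t + 1 / gam v * (v * t) - 1 / gam v * y)) hle (hg.add hh)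
      (by fun_prop))
    (intervalIntegrable_ofReal_mul (f := fun y => g y - h y) hle (hg.sub hh) hw)]
  congr 1
  refine intervalIntegral.integral_congr_Ioo_of_le hle fun x hx => ?_
  simp only [extX_of_mem hx, extT_of_mem hx]

/-- With `A` and `B` the integrals of `(g + h)²` and `(g - h)²` over the string, the left side is `γ
A + B`, and the integral on the right is `A + B / γ`. -/
lemma integral_ext_sub_sq (hv0 : 0 < v) (hv1 : v < 1) (hL : 0 < L)
    (hg : MemLp g 2 (volume.restrict (Ioo (v * t) (L + v * t))))
    (hh : MemLp h 2 (volume.restrict (Ioo (v * t) (L + v * t)))) :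
    ∫ x in (-L1 v L + v * t)..(L + v * t), (extX v L t g x - extT v L t h x) ^ 2
      = gam v * ∫ x in (v * t)..(L2 v L + v * t), (extX v L t g x + extT v L t h x) ^ 2 := by
  have hγ := gam_pos hv0 hv1
  have hle : v * t ≤ L + v * t := by linarith
  have hl := isReflection_left hv0 hv1 hL hg hh
  have hr := isReflection_right hv0 hv1 hL ⟨le_rfl, by linarith⟩ hg hh
  have hl2 := hl.memLp_right
  have hli := hl.integral_sq
  have hr2 := hr.memLp_right
  have hri := hr.integral_sq
  rw [left_endpoint hv0, add_sub_cancel_right] at hl2 hli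
  rw [right_endpoint hv1, add_sub_cancel_right] at hr2 hri
  have hle2 : L + v * t ≤ L2 v L + v * t := by
    rw [L2_eq hv1]
    nlinarith
  rw [← intervalIntegral.integral_add_adjacent_intervals
    (intervalIntegrable_sq_of_memLp (neg_L1_le hv0 hv1 hL) hl2)
    (intervalIntegrable_sq_of_memLp hle (memLp_sub_middle hg hh)), hli,
    ← intervalIntegral.integral_add_adjacent_intervals
    (intervalIntegrable_sq_of_memLp hle (memLp_add_middle hg hh))
    (intervalIntegrable_sq_of_memLp hle2 hr2), hri,
    intervalIntegral.integral_congr_Ioo_of_le (f := fun x => (extX v L t g x - extT v L t h x) ^ 2)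
      (g := fun x => (g x - h x) ^ 2) hle
      (fun x hx => by simp only [extX_of_mem hx, extT_of_mem hx]),
    intervalIntegral.integral_congr_Ioo_of_le (f := fun x => (extX v L t g x + extT v L t h x) ^ 2)
      (g := fun x => (g x + h x) ^ 2) hle
      (fun x hx => by simp only [extX_of_mem hx, extT_of_mem hx])]
  field_simp

end extension

/-! ### Modes and their conserved amplitudes -/

/-- The wave number of the `n`-th mode. -/
noncomputable def waveNumber (v L : ℝ) (n : ℤ) : ℝ := n * Real.pi * (1 - v) / L

/-- The exponential `s ↦ exp (-i κ s)`. -/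
noncomputable def mode (κ s : ℝ) : ℂ := Complex.exp (-(κ * s * Complex.I))

lemma continuous_mode (κ : ℝ) : Continuous (mode κ) := by
  unfold mode; fun_prop

lemma mode_eq (κ s : ℝ) : mode κ s = (Real.cos (κ * s) : ℂ) - (Real.sin (κ * s) : ℂ) * Complex.I := by
  rw [mode, ← neg_mul, Complex.exp_mul_I, Complex.cos_neg, Complex.sin_neg]
  push_cast
  ring

lemma mode_add (κ r s : ℝ) : mode κ (r + s) = mode κ r * mode κ s := by
  rw [mode, mode, mode, ← Complex.exp_add]
  congr 1
  push_cast
  ring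

lemma conj_mode (κ s : ℝ) : (starRingEnd ℂ) (mode κ s) = mode κ (-s) := by
  rw [mode, mode, ← Complex.exp_conj]
  simp

lemma norm_mode (κ s : ℝ) : ‖mode κ s‖ = 1 := by
  rw [mode, Complex.norm_exp]
  simp

lemma waveNumber_mul_L2 {v L : ℝ} (hv1 : v < 1) (hL : 0 < L) (n : ℤ) :
    waveNumber v L n * L2 v L = n * (2 * Real.pi) := by
  have : 1 - v ≠ 0 := by linarith
  rw [waveNumber, L2]
  field_simp

lemma waveNumber_ne_zero {v L : ℝ} (hv1 : v < 1) (hL : 0 < L) {n : ℤ} (hn : n ≠ 0) :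
    waveNumber v L n ≠ 0 := by
  have h1 : 1 - v ≠ 0 := by linarith
  have h2 : (n : ℝ) ≠ 0 := by exact_mod_cast hn
  have h3 := Real.pi_ne_zero
  rw [waveNumber]
  positivity

lemma mode_periodic {v L : ℝ} (hv1 : v < 1) (hL : 0 < L) (n : ℤ) :
    Function.Periodic (mode (waveNumber v L n)) (L2 v L) := by
  intro s
  rw [mode_eq, mode_eq, mul_add, waveNumber_mul_L2 hv1 hL, Real.cos_add_int_mul_two_pi,
    Real.sin_add_int_mul_two_pi]

lemma isProfile_cos {κ P : ℝ} {n : ℤ} (h : κ * P = n * (2 * Real.pi)) :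
    IsProfile P |κ| (fun s => Real.cos (κ * s)) (fun s => -κ * Real.sin (κ * s))
      (fun s => -κ ^ 2 * Real.cos (κ * s)) where
  contDiff := by fun_prop
  contDiff_deriv := by fun_prop
  continuous_deriv_two := by fun_prop
  hasDerivAt s := by
    refine ((Real.hasDerivAt_cos _).comp s ((hasDerivAt_id s).const_mul κ)).congr_deriv ?_
    simp only [id_eq]
    ring
  hasDerivAt_deriv s := by
    refine (((Real.hasDerivAt_sin _).comp s ((hasDerivAt_id s).const_mul κ)).const_mul
      (-κ)).congr_deriv ?_
    simp only [id_eq]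
    ring
  periodic s := by simp only [mul_add, h, Real.cos_add_int_mul_two_pi]
  abs_deriv_le s := by
    rw [abs_mul, abs_neg]
    exact mul_le_of_le_one_right (abs_nonneg _) (Real.abs_sin_le_one _)

lemma isProfile_sin {κ P : ℝ} {n : ℤ} (h : κ * P = n * (2 * Real.pi)) :
    IsProfile P |κ| (fun s => Real.sin (κ * s)) (fun s => κ * Real.cos (κ * s))
      (fun s => -κ ^ 2 * Real.sin (κ * s)) where
  contDiff := by fun_prop
  contDiff_deriv := by fun_prop
  continuous_deriv_two := by fun_prop
  hasDerivAt s := by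
    refine ((Real.hasDerivAt_sin _).comp s ((hasDerivAt_id s).const_mul κ)).congr_deriv ?_
    simp only [id_eq]
    ring
  hasDerivAt_deriv s := by
    refine (((Real.hasDerivAt_cos _).comp s ((hasDerivAt_id s).const_mul κ)).const_mul
      κ).congr_deriv ?_
    simp only [id_eq]
    ring
  periodic s := by simp only [mul_add, h, Real.sin_add_int_mul_two_pi]
  abs_deriv_le s := by
    rw [abs_mul]
    exact mul_le_of_le_one_right (abs_nonneg _) (Real.abs_cos_le_one _)

/-- The amplitude of a mode in terms of the space derivative `g` and the velocity `h` at
time `t`. -/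
noncomputable def modeIntegral (v L t κ : ℝ) (g h : ℝ → ℝ) : ℂ :=
  ∫ y in (v * t)..(L + v * t), (((g y + h y : ℝ) : ℂ) * mode κ (t + y)
    + ((g y - h y : ℝ) : ℂ) * mode κ (gam v * (t - y)))

/-- Wronskians are taken with real profiles, so the complex mode is split into its cosine and sine
parts. -/
lemma modeIntegral_eq_wronskian {v L t κ P : ℝ} {n : ℤ} (hL : 0 < L) {u g h : ℝ → ℝ}
    (hκ : κ * P = n * (2 * Real.pi)) (hu : IsH10 (v * t) (L + v * t) u g)
    (hh : MemLp h 2 (volume.restrict (Ioo (v * t) (L + v * t)))) :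
    modeIntegral v L t κ g h
      = (wronskian v L (fun s => Real.cos (κ * s)) (fun s => -κ * Real.sin (κ * s)) u h t : ℂ)
        - (wronskian v L (fun s => Real.sin (κ * s)) (fun s => κ * Real.cos (κ * s)) u h t : ℂ)
          * Complex.I := by
  have hle : v * t ≤ L + v * t := by linarith
  have hg := intervalIntegrable_of_memLp hle hu.memLp_deriv
  have hh' := intervalIntegrable_of_memLp hle hh
  have hint : ∀ {e : ℝ → ℝ}, Continuous e → IntervalIntegrable (fun x =>
      ((((g x + h x) * e (t + x) + (g x - h x) * e (gam v * (t - x))) : ℝ) : ℂ)) volume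
      (v * t) (L + v * t) := by
    intro e he
    have h1 : IntervalIntegrable (fun x => (g x + h x) * e (t + x)
        + (g x - h x) * e (gam v * (t - x))) volume (v * t) (L + v * t) :=
      ((hg.add hh').mul_continuousOn (by fun_prop)).add
        ((hg.sub hh').mul_continuousOn (by fun_prop))
    rw [intervalIntegrable_iff] at h1 ⊢
    exact h1.ofReal
  rw [wronskian_eq_integral hL (isProfile_cos hκ) hu hh',
    wronskian_eq_integral hL (isProfile_sin hκ) hu hh', ← intervalIntegral.integral_ofReal,
    ← intervalIntegral.integral_ofReal, ← intervalIntegral.integral_mul_const,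
    ← intervalIntegral.integral_sub (hint (e := fun s => Real.cos (κ * s)) (by fun_prop))
      ((hint (e := fun s => Real.sin (κ * s)) (by fun_prop)).mul_const _),
    modeIntegral]
  refine intervalIntegral.integral_congr fun x _ => ?_
  simp only [mode_eq]
  push_cast
  ring

/-- For a constant profile the two travelling waves cancel. This disposes of the index `n = 0`, for
which there is no coefficient. -/
lemma modeIntegral_zero {v L t : ℝ} (hL : 0 < L) {u g h : ℝ → ℝ}
    (hu : IsH10 (v * t) (L + v * t) u g) (hh : MemLp h 2 (volume.restrict (Ioo (v * t) (L + v * t)))) :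
    modeIntegral v L t 0 g h = 0 := by
  rw [modeIntegral_eq_wronskian (P := 0) (n := 0) hL (by simp) hu hh]
  simp [wronskian, waveDiff, waveDiffT]

/-- The amplitudes of the modes are conserved. -/
theorem IsSolution.modeIntegral_eq {v L T : ℝ} {φ0 φ0x φ1 : ℝ → ℝ} {φ φx φt : ℝ → ℝ → ℝ}
    (hφ : IsSolution v L T φ0 φ1 φ φx φt) (hv0 : 0 < v) (hv1 : v < 1) (hL : 0 < L) (hT : 0 < T)
    (hφ0 : IsH10 0 L φ0 φ0x) (hφ1 : MemLp φ1 2 (volume.restrict (Ioo 0 L))) (n : ℤ) {t : ℝ}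
    (ht : t ∈ Icc 0 T) :
    modeIntegral v L t (waveNumber v L n) (fun x => φx x t) (fun x => φt x t)
      = modeIntegral v L 0 (waveNumber v L n) φ0x φ1 := by
  have hκ := waveNumber_mul_L2 hv1 hL n
  have hw : ∀ e e1 : ℝ → ℝ, wronskian v L e e1 (fun x => φ x 0) (fun x => φt x 0) 0
      = wronskian v L e e1 φ0 φ1 0 := by
    intro e e1
    simp only [wronskian, mul_zero, add_zero]
    congr 1
    · rw [intervalIntegral.integral_of_le hL.le, intervalIntegral.integral_of_le hL.le,
        integral_Ioc_eq_integral_Ioo, integral_Ioc_eq_integral_Ioo]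
      refine integral_congr_ae (hφ.initial_t.mono fun x hx => ?_)
      simp only [hx]
    · exact intervalIntegral.integral_congr_Ioo_of_le hL.le fun x hx => by
        simp only [hφ.initial x hx]
  rw [modeIntegral_eq_wronskian hL hκ (hφ.isH10 t ht) (hφ.memLp_t t ht),
    modeIntegral_eq_wronskian hL hκ (u := φ0) (by simpa using hφ0) (by simpa using hφ1),
    hφ.wronskian_eq hv0 hv1 hL hT (isProfile_cos hκ) t ht,
    hφ.wronskian_eq hv0 hv1 hL hT (isProfile_sin hκ) t ht, hw, hw]

/-- After folding the extension back, the reflected point equals `γ (t - y) - t` up to one period of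
the mode, and the point `y` equals `(t + y) - t`; the common shift gives the phase factor. -/
lemma integral_ext_add_mul_mode {v L t : ℝ} {g h : ℝ → ℝ} (hv0 : 0 < v) (hv1 : v < 1) (hL : 0 < L)
    (hg : MemLp g 2 (volume.restrict (Ioo (v * t) (L + v * t))))
    (hh : MemLp h 2 (volume.restrict (Ioo (v * t) (L + v * t)))) (n : ℤ) :
    ∫ x in (v * t)..(L2 v L + v * t), ((extX v L t g x + extT v L t h x : ℝ) : ℂ)
        * mode (waveNumber v L n) x
      = mode (waveNumber v L n) (-t) * modeIntegral v L t (waveNumber v L n) g h := by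
  have h1 := integral_ext_add_mul hv0 hv1 hL ⟨le_refl (v * t), by linarith⟩ hg hh
    (continuous_mode (waveNumber v L n))
  rw [add_sub_cancel_right] at h1
  rw [h1, modeIntegral, ← intervalIntegral.integral_const_mul]
  refine intervalIntegral.integral_congr fun y _ => ?_
  have e1 : mode (waveNumber v L n) y
      = mode (waveNumber v L n) (-t) * mode (waveNumber v L n) (t + y) := by
    rw [← mode_add]; congr 1; ring
  have e2 : mode (waveNumber v L n) (L2 v L + v * t + gam v * (v * t) - gam v * y)
      = mode (waveNumber v L n) (-t) * mode (waveNumber v L n) (gam v * (t - y)) := by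
    rw [← mode_add, ← mode_periodic hv1 hL n (-t + gam v * (t - y))]
    congr 1
    linear_combination (-t) * gam_mul_one_sub hv1
  simp only [e1, e2]
  ring

lemma coeff_eq {v L : ℝ} {g h : ℝ → ℝ} (hv0 : 0 < v) (hv1 : v < 1) (hL : 0 < L)
    (hg : MemLp g 2 (volume.restrict (Ioo 0 L))) (hh : MemLp h 2 (volume.restrict (Ioo 0 L)))
    (n : ℤ) : coeff v L g h n
      = 1 / (4 * n * Real.pi * Complex.I) * modeIntegral v L 0 (waveNumber v L n) g h := by
  have h1 := integral_ext_add_mul_mode (t := 0) hv0 hv1 hL (by simpa using hg) (by simpa using hh) n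
  have h0 : mode (waveNumber v L n) (-0) = 1 := by simp [mode]
  rw [h0, one_mul, mul_zero, add_zero] at h1
  rw [coeff, ← h1]
  congr 1
  refine intervalIntegral.integral_congr fun x _ => ?_
  simp only [mode, waveNumber]
  congr 2
  push_cast
  ring

/-- The exponential in `coeff'` is the mode evaluated at `γ (0 - x)`, since `γ (1 - v) = 1 + v`.
Folding the left extension back then yields the same amplitude as for `coeff`. -/
lemma coeff'_eq {v L : ℝ} {g h : ℝ → ℝ} (hv0 : 0 < v) (hv1 : v < 1) (hL : 0 < L)
    (hg : MemLp g 2 (volume.restrict (Ioo 0 L))) (hh : MemLp h 2 (volume.restrict (Ioo 0 L)))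
    (n : ℤ) : coeff' v L g h n
      = 1 / (4 * n * Real.pi * Complex.I) * modeIntegral v L 0 (waveNumber v L n) g h := by
  have h1 := integral_ext_sub_mul (t := 0) hv0 hv1 hL (by simpa using hg) (by simpa using hh)
    (w := fun x => mode (waveNumber v L n) (gam v * (0 - x)))
    ((continuous_mode _).comp (by fun_prop))
  have hγ := (gam_pos hv0 hv1).ne'
  have h1v : (1 - v : ℂ) ≠ 0 := by
    have : (1 - v : ℝ) ≠ 0 := by linarith
    exact_mod_cast this
  have hL0 : (L : ℂ) ≠ 0 := by exact_mod_cast hL.ne'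
  rw [coeff', modeIntegral]
  congr 1
  refine Eq.trans ?_ (h1.trans ?_)
  · rw [mul_zero, add_zero, add_zero]
    refine intervalIntegral.integral_congr fun x _ => ?_
    simp only [mode, waveNumber, gam]
    congr 2
    push_cast
    field_simp
    ring
  · refine intervalIntegral.integral_congr fun y _ => ?_
    congr 3
    field_simp
    ring

/-! ### Fourier series of the extended data: energy identity and expansion -/

lemma fourierCoeffOn_eq_integral_mode {v L a b : ℝ} (hv1 : v < 1) (hL : 0 < L) (hab : a < b)
    (h : b - a = L2 v L) (f : ℝ → ℂ) (n : ℤ) :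
    fourierCoeffOn hab f n = (L2 v L : ℂ)⁻¹ * ∫ x in a..b, f x * mode (waveNumber v L n) x := by
  have hL2 : L2 v L ≠ 0 := mul_ne_zero (div_ne_zero two_ne_zero (by linarith)) hL.ne'
  have hκ : (waveNumber v L n : ℂ) = n * (2 * Real.pi) / L2 v L := by
    rw [eq_div_iff (by exact_mod_cast hL2)]
    exact_mod_cast waveNumber_mul_L2 hv1 hL n
  rw [fourierCoeffOn_eq_integral, one_div, h, Complex.real_smul, Complex.ofReal_inv]
  congr 1
  refine intervalIntegral.integral_congr fun x _ => ?_
  simp only [fourier_coe_apply, smul_eq_mul, mode, hκ]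
  rw [mul_comm]
  congr 2
  push_cast
  ring

/-- The Fourier coefficients of an indicator function. -/
lemma fourierCoeffOn_indicator {v L a b x y : ℝ} (hv1 : v < 1) (hL : 0 < L) (hab : a < b)
    (h : b - a = L2 v L) (hax : a ≤ x) (hxy : x ≤ y) (hyb : y ≤ b) {n : ℤ} (hn : n ≠ 0) :
    fourierCoeffOn hab ((Ioc x y).indicator fun _ => (1 : ℂ)) n = (L2 v L : ℂ)⁻¹ *
      ((mode (waveNumber v L n) y - mode (waveNumber v L n) x)
        / (-(waveNumber v L n * Complex.I))) := by
  have hκ : (waveNumber v L n : ℂ) ≠ 0 := by exact_mod_cast waveNumber_ne_zero hv1 hL hn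
  rw [fourierCoeffOn_eq_integral_mode hv1 hL hab h]
  congr 1
  have h1 : ∀ s, (Ioc x y).indicator (fun _ => (1 : ℂ)) s * mode (waveNumber v L n) s
      = (Ioc x y).indicator (mode (waveNumber v L n)) s := by
    intro s
    by_cases hs : s ∈ Ioc x y <;> simp [hs]
  have h2 : ∀ s, mode (waveNumber v L n) s
      = Complex.exp (-(waveNumber v L n * Complex.I) * s) := by
    intro s
    rw [mode]
    congr 1
    ring
  simp_rw [h1]
  rw [intervalIntegral.integral_of_le hab.le, setIntegral_indicator measurableSet_Ioc,
    inter_eq_self_of_subset_right (Ioc_subset_Ioc hax hyb), ← intervalIntegral.integral_of_le hxy]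
  simp_rw [h2]
  exact integral_exp_mul_complex (neg_ne_zero.2 (mul_ne_zero hκ Complex.I_ne_zero))

lemma memLp_ofReal_Ioc {a b : ℝ} {f : ℝ → ℝ} (hf : MemLp f 2 (volume.restrict (Ioo a b))) :
    MemLp (fun x => (f x : ℂ)) 2 (volume.restrict (Ioc a b)) := by
  rw [← restrict_Ioo_eq_restrict_Ioc]
  exact hf.ofReal

lemma hasSum_ne_zero {f : ℤ → ℂ} {a : ℂ} (hf : HasSum f a) (h0 : f 0 = 0) :
    HasSum (fun n : {n : ℤ // n ≠ 0} => f n) a := by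
  refine (hasSum_subtype_iff_of_support_subset (s := {n : ℤ | n ≠ 0}) fun n hn => ?_).2 hf
  rintro rfl
  exact hn h0

section expansion

variable {v L t : ℝ} {u g h : ℝ → ℝ} {c : ℤ → ℂ}

/-- The formula holds for every `n`: at `n = 0` both sides vanish, whatever `c 0` is. Thus
Parseval's identity sees no term outside the expansion. -/
lemma fourierCoeffOn_ext_add (hv0 : 0 < v) (hv1 : v < 1) (hL : 0 < L)
    (hu : IsH10 (v * t) (L + v * t) u g)
    (hh : MemLp h 2 (volume.restrict (Ioo (v * t) (L + v * t))))
    (hc : ∀ n : ℤ, n ≠ 0 →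
      modeIntegral v L t (waveNumber v L n) g h = 4 * n * Real.pi * Complex.I * c n)
    (hlt : v * t < L2 v L + v * t) (n : ℤ) :
    fourierCoeffOn hlt (fun x => ((extX v L t g x + extT v L t h x : ℝ) : ℂ)) n
      = (L2 v L : ℂ)⁻¹ * (mode (waveNumber v L n) (-t) * (4 * n * Real.pi * Complex.I * c n)) := by
  rw [fourierCoeffOn_eq_integral_mode hv1 hL hlt (by ring),
    integral_ext_add_mul_mode hv0 hv1 hL hu.memLp_deriv hh]
  rcases eq_or_ne n 0 with rfl | hn
  · have : waveNumber v L 0 = 0 := by simp [waveNumber]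
    rw [this, modeIntegral_zero hL hu hh]
    simp
  · rw [hc n hn]

/-- The energy identity. -/
lemma hasSum_norm_sq (hv0 : 0 < v) (hv1 : v < 1) (hL : 0 < L)
    (hu : IsH10 (v * t) (L + v * t) u g)
    (hh : MemLp h 2 (volume.restrict (Ioo (v * t) (L + v * t))))
    (hc : ∀ n : ℤ, n ≠ 0 →
      modeIntegral v L t (waveNumber v L n) g h = 4 * n * Real.pi * Complex.I * c n) :
    HasSum (fun n : {n : ℤ // n ≠ 0} => ‖((n : ℤ) : ℂ) * c n‖ ^ 2)
      (L / (8 * Real.pi ^ 2 * (1 - v)) *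
        ∫ x in (v * t)..(L2 v L + v * t), (extX v L t g x + extT v L t h x) ^ 2) := by
  have h1v : 0 < 1 - v := by linarith
  have hL2 : 0 < L2 v L := mul_pos (div_pos two_pos h1v) hL
  have hlt : v * t < L2 v L + v * t := by linarith
  have hP := hasSum_sq_fourierCoeffOn hlt
    (memLp_ofReal_Ioc (memLp_ext_add hv0 hv1 hL hu.memLp_deriv hh))
  simp_rw [fourierCoeffOn_ext_add hv0 hv1 hL hu hh hc hlt] at hP
  rw [add_sub_cancel_right] at hP
  have hpi := Real.pi_pos
  -- Each Fourier coefficient has modulus `4 π |n c n| / L₂`, so this factor normalises the terms.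
  have hP' := hP.mul_left ((L2 v L) ^ 2 / (16 * Real.pi ^ 2))
  have hterm : ∀ n : ℤ, (L2 v L) ^ 2 / (16 * Real.pi ^ 2) *
      ‖(L2 v L : ℂ)⁻¹ * (mode (waveNumber v L n) (-t) * (4 * n * Real.pi * Complex.I * c n))‖ ^ 2
        = ‖(n : ℂ) * c n‖ ^ 2 := by
    intro n
    simp only [norm_mul, norm_inv, norm_mode, Complex.norm_real, Complex.norm_I, Real.norm_eq_abs,
      abs_of_pos hL2, abs_of_pos hpi, Complex.norm_ofNat]
    field_simp
    ring
  simp_rw [hterm] at hP'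
  have hval : (L2 v L) ^ 2 / (16 * Real.pi ^ 2) * ((L2 v L)⁻¹ •
      ∫ x in (v * t)..(L2 v L + v * t), ‖((extX v L t g x + extT v L t h x : ℝ) : ℂ)‖ ^ 2)
      = L / (8 * Real.pi ^ 2 * (1 - v)) *
        ∫ x in (v * t)..(L2 v L + v * t), (extX v L t g x + extT v L t h x) ^ 2 := by
    simp_rw [Complex.norm_real, Real.norm_eq_abs, sq_abs]
    rw [smul_eq_mul, ← mul_assoc]
    congr 1
    rw [L2]
    field_simp
    norm_num
  rw [hval] at hP'
  refine (hasSum_subtype_iff_of_support_subset (s := {n : ℤ | n ≠ 0}) fun n hn => ?_).2 hP'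
  rintro rfl
  simp at hn

/-- The integral of the extension between two reflected points. -/
lemma integral_ext_add_reflected (hv0 : 0 < v) (hv1 : v < 1) (hL : 0 < L)
    (hu : IsH10 (v * t) (L + v * t) u g)
    (hh : MemLp h 2 (volume.restrict (Ioo (v * t) (L + v * t)))) {x : ℝ}
    (hx : x ∈ Ioo (v * t) (L + v * t)) :
    ∫ s in x..(L2 v L + v * t + gam v * (v * t) - gam v * x),
      ((extX v L t g s + extT v L t h s : ℝ) : ℂ) = -2 * u x := by
  -- With weight `1` the velocity cancels between the two folded halves, leaving `2 ∫ g` from `x` to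
  -- the right endpoint, which is `-2 u x`.
  have h1 := integral_ext_add_mul hv0 hv1 hL ⟨hx.1.le, hx.2⟩ hu.memLp_deriv hh
    (continuous_const (y := (1 : ℂ)))
  simp only [mul_one] at h1
  have hlt : v * t < L + v * t := by linarith
  have hi := hu.intervalIntegrable_deriv hlt
  have h2 := intervalIntegral.integral_add_adjacent_intervals
    (hi.mono_set (uIcc_subset_uIcc left_mem_uIcc (Icc_subset_uIcc ⟨hx.1.le, hx.2.le⟩)))
    (hi.mono_set (uIcc_subset_uIcc (Icc_subset_uIcc ⟨hx.1.le, hx.2.le⟩) right_mem_uIcc))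
  rw [hu.integral_deriv_eq_zero hlt, ← hu.eq_integral hlt ⟨hx.1.le, hx.2.le⟩] at h2
  rw [h1, neg_mul, ← mul_neg, ← Complex.ofReal_neg, ← eq_neg_of_add_eq_zero_right h2,
    ← intervalIntegral.integral_ofReal, ← intervalIntegral.integral_const_mul]
  refine intervalIntegral.integral_congr fun y _ => ?_
  push_cast
  ring

/-- The expansion in modes. -/
lemma hasSum_expansion (hv0 : 0 < v) (hv1 : v < 1) (hL : 0 < L)
    (hu : IsH10 (v * t) (L + v * t) u g)
    (hh : MemLp h 2 (volume.restrict (Ioo (v * t) (L + v * t))))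
    (hc : ∀ n : ℤ, n ≠ 0 →
      modeIntegral v L t (waveNumber v L n) g h = 4 * n * Real.pi * Complex.I * c n) {x : ℝ}
    (hx : x ∈ Ioo (v * t) (L + v * t)) :
    HasSum (fun n : {n : ℤ // n ≠ 0} => c n * (mode (waveNumber v L n) (-(t + x))
      - mode (waveNumber v L n) (-(gam v * (t - x))))) (u x : ℂ) := by
  have h1v : 0 < 1 - v := by linarith
  have hγ := gam_pos hv0 hv1
  have hL2 : 0 < L2 v L := mul_pos (div_pos two_pos h1v) hL
  have hlt : v * t < L2 v L + v * t := by linarith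
  set x' := L2 v L + v * t + gam v * (v * t) - gam v * x with hx'
  have hb := right_endpoint (L := L) (t := t) hv1
  have hxx' : x ≤ x' := by
    have := mul_lt_mul_of_pos_left hx.2 hγ
    linarith [hx.2]
  have hx'c : x' ≤ L2 v L + v * t := by
    have := mul_lt_mul_of_pos_left hx.1 hγ
    linarith
  -- Integration over `(x, x']` is an `L²` pairing, so Parseval's identity gives convergence at each
  -- single point `x`.
  have hchi : MemLp ((Ioc x x').indicator fun _ => (1 : ℂ)) 2
      (volume.restrict (Ioc (v * t) (L2 v L + v * t))) :=
    memLp_indicator_const 2 measurableSet_Ioc 1 (Or.inr (measure_lt_top _ _).ne)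
  have hS := hasSum_conj_fourierCoeffOn_mul hlt hchi
    (memLp_ofReal_Ioc (memLp_ext_add hv0 hv1 hL hu.memLp_deriv hh))
  simp_rw [fourierCoeffOn_ext_add hv0 hv1 hL hu hh hc hlt] at hS
  rw [add_sub_cancel_right] at hS
  have hval : ∫ s in (v * t)..(L2 v L + v * t),
      (starRingEnd ℂ) ((Ioc x x').indicator (fun _ => (1 : ℂ)) s)
        * ((extX v L t g s + extT v L t h s : ℝ) : ℂ) = -2 * u x := by
    rw [← integral_ext_add_reflected hv0 hv1 hL hu hh hx]
    have h1 : ∀ s, (starRingEnd ℂ) ((Ioc x x').indicator (fun _ => (1 : ℂ)) s)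
        * ((extX v L t g s + extT v L t h s : ℝ) : ℂ)
        = (Ioc x x').indicator (fun s => ((extX v L t g s + extT v L t h s : ℝ) : ℂ)) s := by
      intro s
      by_cases hs : s ∈ Ioc x x' <;> simp [hs]
    simp_rw [h1]
    rw [intervalIntegral.integral_of_le hlt.le, setIntegral_indicator measurableSet_Ioc,
      inter_eq_self_of_subset_right (Ioc_subset_Ioc hx.1.le hx'c),
      ← intervalIntegral.integral_of_le hxx']
  rw [hval] at hS
  -- The factor undoes the normalisation `1 / L₂` in Parseval's identity and the `-2` in the
  -- reflected integral.
  have hS' := (hasSum_ne_zero hS (by simp)).mul_left (-(L2 v L : ℂ) / 2)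
  have hL2c : (L2 v L : ℂ) ≠ 0 := by exact_mod_cast hL2.ne'
  have hlim : -(L2 v L : ℂ) / 2 * ((L2 v L)⁻¹ • (-2 * (u x : ℂ))) = u x := by
    rw [Complex.real_smul]
    push_cast
    field_simp
  rw [hlim] at hS'
  refine hS'.congr_fun fun ⟨n, hn⟩ => ?_
  have hκ : (waveNumber v L n : ℂ) ≠ 0 := by exact_mod_cast waveNumber_ne_zero hv1 hL hn
  have hκ2 : (waveNumber v L n : ℂ) * L2 v L = n * (2 * Real.pi) := by
    exact_mod_cast waveNumber_mul_L2 hv1 hL n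
  have e1 : mode (waveNumber v L n) (-(t + x))
      = mode (waveNumber v L n) (-x) * mode (waveNumber v L n) (-t) := by
    rw [← mode_add]; congr 1; ring
  -- The endpoint `x'` of the indicator produces the second exponential of the mode: modulo the
  -- period, `x' + t` is the phase `γ (t - x)`.
  have e2 : mode (waveNumber v L n) (-(gam v * (t - x)))
      = mode (waveNumber v L n) (-x') * mode (waveNumber v L n) (-t) := by
    rw [← mode_add, ← mode_periodic hv1 hL n (-x' + -t)]
    congr 1
    rw [hx']
    linear_combination (-t) * gam_mul_one_sub hv1
  simp only []
  rw [fourierCoeffOn_indicator hv1 hL hlt (by ring) hx.1.le hxx' hx'c hn, e1, e2]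
  simp only [map_mul, map_inv₀, map_div₀, map_neg, map_sub, conj_mode, Complex.conj_ofReal,
    Complex.conj_I]
  field_simp
  linear_combination (2 * c n * (mode (waveNumber v L n) (-x)
    - mode (waveNumber v L n) (-x')) * mode (waveNumber v L n) (-t)) * hκ2

end expansion

end MovingString

/-! ### The main theorem -/

theorem corollary2p1 (v L T : ℝ) (hv0 : 0 < v) (hv1 : v < 1) (hL : 0 < L) (hT : 0 < T)
    (φ0 φ0x φ1 : ℝ → ℝ) (hφ0 : MovingString.IsH10 0 L φ0 φ0x)
    (hφ1 : MemLp φ1 2 (volume.restrict (Ioo 0 L)))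
    (φ φx φt : ℝ → ℝ → ℝ) (hφ : MovingString.IsSolution v L T φ0 φ1 φ φx φt)
    (c : ℤ → ℂ) (hc : ∀ n : ℤ, n ≠ 0 → c n = MovingString.coeff v L φ0x φ1 n) :
    -- the second formula for `c n`, and the expansion of `φ` whose coefficients are the `c n`
    (∀ n : ℤ, n ≠ 0 → c n = MovingString.coeff' v L φ0x φ1 n) ∧
    (∀ t ∈ Icc 0 T, ∀ x ∈ Ioo (v * t) (L + v * t),
      HasSum (fun n : {n : ℤ // n ≠ 0} => c n *
        (Complex.exp ((n : ℤ) * Real.pi * Complex.I * (1 - v) * (t + x) / L)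
          - Complex.exp ((n : ℤ) * Real.pi * Complex.I * (1 + v) * (t - x) / L)))
        (φ x t : ℂ)) ∧
    -- finiteness of the sum and its two expressions
    Summable (fun n : {n : ℤ // n ≠ 0} => ‖((n : ℤ) : ℂ) * c n‖ ^ 2) ∧
    ∀ t ∈ Icc 0 T,
      ∑' n : {n : ℤ // n ≠ 0}, ‖((n : ℤ) : ℂ) * c n‖ ^ 2
        = L / (8 * Real.pi ^ 2 * (1 - v)) *
          ∫ x in (v * t)..(MovingString.L2 v L + v * t),
            (MovingString.extX v L t (fun y => φx y t) x
              + MovingString.extT v L t (fun y => φt y t) x) ^ 2 ∧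
      ∑' n : {n : ℤ // n ≠ 0}, ‖((n : ℤ) : ℂ) * c n‖ ^ 2
        = L / (8 * Real.pi ^ 2 * (1 + v)) *
          ∫ x in (-MovingString.L1 v L + v * t)..(L + v * t),
            (MovingString.extX v L t (fun y => φx y t) x
              - MovingString.extT v L t (fun y => φt y t) x) ^ 2 := by
  -- Conservation enters only here: the amplitudes at time `t` are expressed by coefficients of the
  -- initial data, after which every claim concerns one fixed time.
  have hmode : ∀ t ∈ Icc 0 T, ∀ n : ℤ, n ≠ 0 →
      MovingString.modeIntegral v L t (MovingString.waveNumber v L n) (fun x => φx x t)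
        (fun x => φt x t) = 4 * n * Real.pi * Complex.I * c n := by
    intro t ht n hn
    have hn' : (n : ℂ) ≠ 0 := by exact_mod_cast hn
    have hpi : (Real.pi : ℂ) ≠ 0 := by exact_mod_cast Real.pi_ne_zero
    have hI := Complex.I_ne_zero
    rw [hφ.modeIntegral_eq hv0 hv1 hL hT hφ0 hφ1 n ht, hc n hn,
      MovingString.coeff_eq hv0 hv1 hL hφ0.memLp_deriv hφ1]
    field_simp
  have henergy := fun t (ht : t ∈ Icc 0 T) =>
    MovingString.hasSum_norm_sq hv0 hv1 hL (hφ.isH10 t ht) (hφ.memLp_t t ht) (hmode t ht)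
  refine ⟨fun n hn => ?_, fun t ht x hx => ?_, (henergy 0 (left_mem_Icc.2 hT.le)).summable,
    fun t ht => ⟨(henergy t ht).tsum_eq, ?_⟩⟩
  · rw [hc n hn, MovingString.coeff_eq hv0 hv1 hL hφ0.memLp_deriv hφ1,
      MovingString.coeff'_eq hv0 hv1 hL hφ0.memLp_deriv hφ1]
  · have h := MovingString.hasSum_expansion hv0 hv1 hL (hφ.isH10 t ht) (hφ.memLp_t t ht)
      (hmode t ht) hx
    have h1v : (1 - v : ℂ) ≠ 0 := by
      have : (1 - v : ℝ) ≠ 0 := by linarith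
      exact_mod_cast this
    have hL0 : (L : ℂ) ≠ 0 := by exact_mod_cast hL.ne'
    refine h.congr_fun fun n => ?_
    simp only [MovingString.mode, MovingString.waveNumber, MovingString.gam]
    congr 3
    · push_cast
      field_simp
    · push_cast
      field_simp
  · rw [(henergy t ht).tsum_eq, MovingString.integral_ext_sub_sq hv0 hv1 hL
      (hφ.isH10 t ht).memLp_deriv (hφ.memLp_t t ht), MovingString.gam, ← mul_assoc]
    -- The constants match because `γ / (1 + v) = 1 / (1 - v)`.
    congr 1
    have h1 : 1 - v ≠ 0 := by linarith
    have h2 : 1 + v ≠ 0 := by linarith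
    field_simp
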